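/- Let $d\ge 1$ and let $X$ be a compact metrizable abelian group. Let $\alpha$ be an algebraic $\mathbb{Z}^d$-action on $X$, that is, a homomorphism $\mathbf{n}\mapsto\alpha^{\mathbf{n}}$ from $\mathbb{Z}^d$ to the group of continuous automorphisms of $X$. Let $Y$ be a compact subgroup of $X$ that is $\alpha$-invariant, i.e. $\alpha^{\mathbf{n}}(Y)=Y$ for all $\mathbf{n}\in\mathbb{Z}^d$; denote by $\alpha_Y$ the restriction of $\alpha$ to $Y$, and by $\alpha_{X/Y}$ the action induced on the quotient group $X/Y$ (with the quotient topology) by $\alpha_{X/Y}^{\mathbf{n}}(x+Y)=\alpha^{\mathbf{n}}(x)+Y$. Let $H=\{\mathbf{x}\in\mathbb{R}^d:\mathbf{x}\cdot\mathbf{v}\le 0\}$ be the half-space with outward unit normal $\mathbf{v}\in\mathbb{R}^d$, $\|\mathbf{v}\|=1$. A $\mathbb{Z}^d$-action $\beta$ by homeomorphisms of a compact metrizable space $Z$, with a metric $\rho$ inducing its topology, is called expansive along a set $F\subset\mathbb{R}^d$ if there are $\varepsilon>0$ and $t>0$ such that, with $F^t=\{\mathbf{x}\in\mathbb{R}^d:\operatorname{dist}(\mathbf{x},F)\le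 t\}$, for all $x,y\in Z$, $$\sup\{\rho(\beta^{\mathbf{n}}(x),\beta^{\mathbf{n}}(y)):\mathbf{n}\in F^t\cap\mathbb{Z}^d\}\le\varepsilon \quad\text{implies}\quad x=y$$ (the supremum over the empty set being $0$). Then, for any choice of metrics inducing the topologies of $X$, $Y$ and $X/Y$, the action $\alpha$ is expansive along $H$ if and only if both $\alpha_Y$ and $\alpha_{X/Y}$ are expansive along $H$. -/

import Mathlib

open scoped ENNReal

noncomputable section

/-- The point of `ℝ^d` with the integer coordinates `n`. -/
def intPoint {d : ℕ} (n : Fin d → ℤ) : EuclideanSpace ℝ (Fin d) :=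
  WithLp.toLp 2 (fun i => (n i : ℝ))

/-- The half-space `H_v = {x ∈ ℝ^d : x · v ≤ 0}`. -/
def halfSpace {d : ℕ} (v : EuclideanSpace ℝ (Fin d)) : Set (EuclideanSpace ℝ (Fin d)) :=
  {x | inner ℝ x v ≤ 0}

/-- The set of all half-spaces `H_v` of `ℝ^d`, where `v` ranges over the unit sphere. -/
def halfSpaces (d : ℕ) : Set (Set (EuclideanSpace ℝ (Fin d))) :=
  {H | ∃ v : EuclideanSpace ℝ (Fin d), ‖v‖ = 1 ∧ H = halfSpace v}

/-- A metric on the topological space `X` that induces the given topology of `X`. -/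
structure CompatibleMetric (X : Type*) [t : TopologicalSpace X] where
  metric : MetricSpace X
  compatible : metric.toUniformSpace.toTopologicalSpace = t

/-- A `ℤ^d`-action on `X`: a homomorphism from `ℤ^d` to the group of homeomorphisms of `X`. -/
abbrev ZdAction (d : ℕ) (X : Type*) [TopologicalSpace X] :=
  Multiplicative (Fin d → ℤ) →* (X ≃ₜ X)

namespace ZdAction

variable {d : ℕ} {X : Type*} [TopologicalSpace X]

/-- `ρ_β^F(x, y)`, the supremum of `ρ (β^n x) (β^n y)` over all `n ∈ F ∩ ℤ^d`, as an element of
`[0, ∞]`; it is `0` if `F ∩ ℤ^d` is empty. -/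
def distAlong (β : ZdAction d X) (ρ : CompatibleMetric X)
    (F : Set (EuclideanSpace ℝ (Fin d))) (x y : X) : ℝ≥0∞ :=
  ⨆ (n : Fin d → ℤ) (_ : intPoint n ∈ F),
    ρ.metric.edist (β (Multiplicative.ofAdd n) x) (β (Multiplicative.ofAdd n) y)

/-- `β` is expansive along `F`, with respect to the metric `ρ`: there are `ε > 0` and `t > 0` such
that `ρ_β^{F^t}(x, y) ≤ ε` implies `x = y`. Here `F^t = {x : dist(x, F) ≤ t}`. -/
def ExpansiveAlong (β : ZdAction d X) (ρ : CompatibleMetric X)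
    (F : Set (EuclideanSpace ℝ (Fin d))) : Prop :=
  ∃ ε : ℝ, 0 < ε ∧ ∃ t : ℝ, 0 < t ∧ ∀ x y : X,
    β.distAlong ρ (Metric.cthickening t F) x y ≤ ENNReal.ofReal ε → x = y

end ZdAction

/-- An algebraic `ℤ^d`-action on the topological abelian group `X`: an action of `ℤ^d` by
homeomorphisms that are group automorphisms. -/
structure AlgebraicZdAction (d : ℕ) (X : Type*) [AddCommGroup X] [TopologicalSpace X] where
  action : ZdAction d X
  action_add : ∀ (n : Multiplicative (Fin d → ℤ)) (x y : X),
    action n (x + y) = action n x + action n y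

namespace AlgebraicZdAction

variable {d : ℕ} {X : Type*} [AddCommGroup X] [TopologicalSpace X]

/-- The subgroup `Y` is `α`-invariant. (As this is required for all `n`, including the inverses,
it says that every `α^n` maps `Y` onto `Y`.) -/
def Invariant (α : AlgebraicZdAction d X) (Y : AddSubgroup X) : Prop :=
  ∀ (n : Multiplicative (Fin d → ℤ)), ∀ y ∈ Y, α.action n y ∈ Y

/-- The endomorphism `α^n` of the group `X`. -/
def endo (α : AlgebraicZdAction d X) (n : Multiplicative (Fin d → ℤ)) : X →+ X :=
  AddMonoidHom.mk' (α.action n) (α.action_add n)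

/-- The restriction `α_Y` of `α` to an invariant subgroup `Y`. -/
def restrict (α : AlgebraicZdAction d X) (Y : AddSubgroup X) (hY : α.Invariant Y) :
    AlgebraicZdAction d Y where
  action :=
    { toFun := fun n =>
        { toFun := fun y => ⟨α.action n y, hY n y y.2⟩
          invFun := fun y => ⟨α.action n⁻¹ y, hY n⁻¹ y y.2⟩
          left_inv := fun y => Subtype.ext (by
            change (α.action n⁻¹ * α.action n) (y : X) = y
            rw [← map_mul, inv_mul_cancel, map_one]; rfl)
          right_inv := fun y => Subtype.ext (by
            change (α.action n * α.action n⁻¹) (y : X) = y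
            rw [← map_mul, mul_inv_cancel, map_one]; rfl)
          continuous_toFun :=
            ((α.action n).continuous.comp continuous_subtype_val).subtype_mk _
          continuous_invFun :=
            ((α.action n⁻¹).continuous.comp continuous_subtype_val).subtype_mk _ }
      map_one' := Homeomorph.ext fun y => Subtype.ext (by
        change α.action 1 (y : X) = y
        rw [map_one]; rfl)
      map_mul' := fun m n => Homeomorph.ext fun y => Subtype.ext (by
        change α.action (m * n) (y : X) = (α.action m * α.action n) (y : X)
        rw [map_mul]) }
  action_add := fun n x y => Subtype.ext (α.action_add n x y)

/-- The map induced by `α^n` on `X / Y`, for an invariant subgroup `Y`: the coset `x + Y` goes to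
`α^n(x) + Y`. -/
def quotientMap (α : AlgebraicZdAction d X) (Y : AddSubgroup X) (hY : α.Invariant Y)
    (n : Multiplicative (Fin d → ℤ)) : X ⧸ Y →+ X ⧸ Y :=
  QuotientAddGroup.map Y Y (α.endo n) (fun y hy => hY n y hy)

theorem quotientMap_mk (α : AlgebraicZdAction d X) (Y : AddSubgroup X) (hY : α.Invariant Y)
    (n : Multiplicative (Fin d → ℤ)) (x : X) :
    α.quotientMap Y hY n (x : X ⧸ Y) = ((α.action n x : X) : X ⧸ Y) := rfl

theorem quotientMap_one (α : AlgebraicZdAction d X) (Y : AddSubgroup X) (hY : α.Invariant Y)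
    (q : X ⧸ Y) : α.quotientMap Y hY 1 q = q := by
  induction q using QuotientAddGroup.induction_on with
  | H x => rw [quotientMap_mk, map_one]; rfl

theorem quotientMap_mul (α : AlgebraicZdAction d X) (Y : AddSubgroup X) (hY : α.Invariant Y)
    (m n : Multiplicative (Fin d → ℤ)) (q : X ⧸ Y) :
    α.quotientMap Y hY (m * n) q = α.quotientMap Y hY m (α.quotientMap Y hY n q) := by
  induction q using QuotientAddGroup.induction_on with
  | H x => rw [quotientMap_mk, quotientMap_mk, quotientMap_mk, map_mul]; rfl

theorem continuous_quotientMap (α : AlgebraicZdAction d X) (Y : AddSubgroup X)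
    (hY : α.Invariant Y) (n : Multiplicative (Fin d → ℤ)) :
    Continuous (α.quotientMap Y hY n) :=
  (QuotientAddGroup.isQuotientMap_mk Y).continuous_iff.2
    (QuotientAddGroup.continuous_mk.comp (α.action n).continuous)

/-- The action `α_{X/Y}` induced by `α` on the quotient (with the quotient topology) by an
invariant subgroup `Y`. -/
def quotient (α : AlgebraicZdAction d X) (Y : AddSubgroup X) (hY : α.Invariant Y) :
    AlgebraicZdAction d (X ⧸ Y) where
  action :=
    { toFun := fun n =>
        { toFun := α.quotientMap Y hY n
          invFun := α.quotientMap Y hY n⁻¹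
          left_inv := fun q => by rw [← quotientMap_mul, inv_mul_cancel, quotientMap_one]
          right_inv := fun q => by rw [← quotientMap_mul, mul_inv_cancel, quotientMap_one]
          continuous_toFun := α.continuous_quotientMap Y hY n
          continuous_invFun := α.continuous_quotientMap Y hY n⁻¹ }
      map_one' := Homeomorph.ext fun q => α.quotientMap_one Y hY q
      map_mul' := fun m n => Homeomorph.ext fun q => α.quotientMap_mul Y hY m n q }
  action_add := fun n x y => map_add (α.quotientMap Y hY n) x y

end AlgebraicZdAction

end

/-! By compactness, and by shifting along an integer vector of positive height, expansiveness along
`H` means that some neighbourhood of 0 contains the half-orbit of no nonzero point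
(`HalfExpansive`). In this form the passage to `Y`, and from `Y` and `X/Y` back to `X`, is
elementary. The quotient is the hard case: a small half-orbit in `X/Y` has no evident lift to a
small one in `X`.

Pontryagin duality settles it. The characters of `X/Y` form a submodule of the dual of `X` over
`ℤ[ℤ^d]`, so it suffices to characterize half-expansiveness by a property of the dual module
inherited by submodules. That property is `HalfSpaceContracted`; it is inherited because `ℤ[ℤ^d]` is
Noetherian and its other clauses are identities valid on all elements.

Contracted implies expansive: if `p` acts as `q > ‖p‖₁`, real lifts of small character values along
a half-orbit satisfy `q w = p w`, hence vanish; an element of negative height acting as 1 extends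
this from generators to all characters.

Expansive implies contracted: finitely many characters generate the dual over the half-space ring,
and Cayley–Hamilton gives the element of negative height. If a basis vector were not an `ℓ¹`-limit
of rational multiples of relations, Hahn–Banach and duality would produce a nonzero point with a
small half-orbit. Hence a matrix of relations is close to an integer diagonal matrix, and its
determinant yields `p` and `q`. -/

/-! ### Compact operators commuting with a group of isometries -/

/-- Induction on dimension: unless every operator is scalar on `W`, an eigenspace of a non-scalar
one cuts `W` down, and commutativity keeps it invariant. -/
theorem exists_common_eigenvector {ι E : Type*} [AddCommGroup E] [Module ℂ E]
    (U : ι → Module.End ℂ E) (hU : ∀ i j, Commute (U i) (U j)) (W : Submodule ℂ E)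
    [FiniteDimensional ℂ W] (hW : W ≠ ⊥) (hinv : ∀ i, ∀ w ∈ W, U i w ∈ W) :
    ∃ f ∈ W, f ≠ 0 ∧ ∀ i, ∃ c : ℂ, U i f = c • f := by
  induction hn : Module.finrank ℂ W using Nat.strong_induction_on generalizing W with
  | _ n ih =>
    subst hn
    by_cases hall : ∀ i, ∃ c : ℂ, ∀ w ∈ W, U i w = c • w
    · obtain ⟨f, hf, hf0⟩ := W.ne_bot_iff.1 hW
      exact ⟨f, hf, hf0, fun i => (hall i).imp fun c hc => hc f hf⟩
    · push Not at hall
      obtain ⟨i, hi⟩ := hall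
      have : Nontrivial W := Submodule.nontrivial_iff_ne_bot.2 hW
      obtain ⟨c, hc⟩ := Module.End.exists_eigenvalue ((U i).restrict (hinv i))
      obtain ⟨v, hv⟩ := hc.exists_hasEigenvector
      have hv1 : U i v = c • (v : E) := congrArg Subtype.val hv.apply_eq_smul
      have hv0 : (v : E) ≠ 0 := fun h => hv.2 (Subtype.ext h)
      obtain ⟨w, hw, hwc⟩ := hi c
      let W' : Submodule ℂ E := W ⊓ Module.End.eigenspace (U i) c
      have hlt : W' < W := by
        refine lt_of_le_of_ne inf_le_left fun h => hwc ?_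
        have : w ∈ W' := h ▸ hw
        exact Module.End.mem_eigenspace_iff.1 this.2
      have : FiniteDimensional ℂ W' := Submodule.finiteDimensional_of_le inf_le_left
      obtain ⟨f, hf, h⟩ := ih _ (Submodule.finrank_lt_finrank_of_lt hlt) W'
        (W'.ne_bot_iff.2 ⟨v, ⟨v.2, Module.End.mem_eigenspace_iff.2 hv1⟩, hv0⟩)
        (fun j x hx => ⟨hinv j x hx.1, by
          have hx2 := Module.End.mem_eigenspace_iff.1 hx.2
          refine Module.End.mem_eigenspace_iff.2 ?_
          have := congrArg (fun T : Module.End ℂ E => T x) (hU i j).eq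
          simp only [Module.End.mul_apply] at this
          rw [this, hx2, map_smul]⟩) rfl
      exact ⟨f, hf.1, h⟩

/-- The spectral theorem applies to `T = A A*`, whose eigenspaces for nonzero eigenvalues are
finite-dimensional, invariant under `τ` and contained in the range of `A`. If `τ a` fixed all of
them, it would fix the range of `A`. -/
theorem exists_eigenvector_of_isCompactOperator {G E : Type*} [AddCommGroup G]
    [NormedAddCommGroup E] [InnerProductSpace ℂ E] [CompleteSpace E]
    (τ : G → E →ₗᵢ[ℂ] E) (hτ0 : ∀ f, τ 0 f = f) (hτ : ∀ a b f, τ (a + b) f = τ a (τ b f))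
    (A : E →L[ℂ] E) (hA : IsCompactOperator A) (hAτ : ∀ a f, A (τ a f) = τ a (A f))
    (a : G) (ha : ∃ f, τ a (A f) ≠ A f) :
    ∃ g : E, A g ≠ 0 ∧ ∃ χ : G → ℂ, (∀ b, τ b (A g) = χ b • A g) ∧ χ a ≠ 1 := by
  by_contra! hcon
  have hadj : ∀ b f g, inner ℂ (τ b f) g = inner ℂ f (τ (-b) g) := by
    intro b f g
    rw [← (τ (-b)).inner_map_map, ← hτ, neg_add_cancel, hτ0]
  have hadj' : ∀ b f g, inner ℂ f (τ b g) = inner ℂ (τ (-b) f) g := by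
    intro b f g
    rw [hadj, neg_neg]
  let B := ContinuousLinearMap.adjoint A
  have hB : ∀ b f, B (τ b f) = τ b (B f) := by
    intro b f
    refine ext_inner_right ℂ fun g => ?_
    rw [ContinuousLinearMap.adjoint_inner_left, hadj, ← hAτ, hadj,
      ContinuousLinearMap.adjoint_inner_left]
  let T : E →L[ℂ] E := A ∘L B
  have hTc : IsCompactOperator T := hA.comp_clm B
  have hTs : (T : E →ₗ[ℂ] E).IsSymmetric := by
    intro f g
    change inner ℂ (A (B f)) g = inner ℂ f (A (B g))
    rw [← ContinuousLinearMap.adjoint_inner_right, ← ContinuousLinearMap.adjoint_inner_left A]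
  have key : ∀ c : ℂ, c ≠ 0 → ∀ w ∈ Module.End.eigenspace (T : E →ₗ[ℂ] E) c, τ a w = w := by
    intro c hc w hw
    by_contra hne
    have := ContinuousLinearMap.finite_dimensional_eigenspace hTc c hc
    set V := Module.End.eigenspace (T : E →ₗ[ℂ] E) c with hV
    have hVmem : ∀ v, v ∈ V ↔ A (B v) = c • v := fun v => Module.End.mem_eigenspace_iff
    have hVinv : ∀ b, ∀ v ∈ V, τ b v ∈ V := by
      intro b v hv
      rw [hVmem] at hv ⊢
      rw [hB, hAτ, hv, map_smul]
    -- The eigenvector is sought in the image of `τ a - 1`, because a vector `f = τ a g - g` fixed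
    -- by the isometry `τ a` is orthogonal to itself. This excludes `χ a = 1`.
    let W : Submodule ℂ E := V.map ((τ a).toLinearMap - LinearMap.id)
    have hWV : W ≤ V := by
      rintro _ ⟨v, hv, rfl⟩
      exact V.sub_mem (hVinv a v hv) hv
    have : FiniteDimensional ℂ W := Submodule.finiteDimensional_of_le hWV
    obtain ⟨f, hfW, hf0, hf⟩ := exists_common_eigenvector (fun b => (τ b).toLinearMap)
      (fun b b' => LinearMap.ext fun x => by
        simp only [Module.End.mul_apply, LinearIsometry.coe_toLinearMap]
        rw [← hτ, ← hτ, add_comm]) W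
      (W.ne_bot_iff.2 ⟨_, ⟨w, hw, rfl⟩, sub_ne_zero.2 hne⟩)
      (by
        rintro b _ ⟨v, hv, rfl⟩
        refine ⟨τ b v, hVinv b v hv, ?_⟩
        simp only [LinearMap.sub_apply, LinearIsometry.coe_toLinearMap, LinearMap.id_apply,
          map_sub]
        rw [← hτ, ← hτ, add_comm])
    choose χ hχ using hf
    have hfV := (hVmem f).1 (hWV hfW)
    have hf1 : f = A (c⁻¹ • B f) := by rw [map_smul, hfV, smul_smul, inv_mul_cancel₀ hc, one_smul]
    have h1 : χ a = 1 := by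
      refine hcon (c⁻¹ • B f) (hf1 ▸ hf0) χ fun b => ?_
      rw [← hf1]
      exact hχ b
    have hfa : τ a f = f := by
      have := hχ a
      rw [h1, one_smul] at this
      exact this
    obtain ⟨g, -, hg⟩ := hfW
    have hg' : f = τ a g - g := hg.symm
    apply hf0
    rw [← inner_self_eq_zero (𝕜 := ℂ)]
    nth_rw 2 [hg']
    rw [inner_sub_right]
    nth_rw 1 [← hfa]
    rw [(τ a).inner_map_map, sub_self]
  -- The vector `τ a (A g) - A g` is orthogonal to every eigenspace of `T`: to the kernel, since it
  -- equals the kernel of `A*`, and to the others, since `τ a` fixes them.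
  obtain ⟨g, hg⟩ := ha
  apply hg
  rw [← sub_eq_zero, ← Submodule.mem_bot ℂ,
    ← ContinuousLinearMap.orthogonalComplement_iSup_eigenspaces_eq_bot hTc hTs,
    ← Submodule.iInf_orthogonal, Submodule.mem_iInf]
  intro c
  rw [Submodule.mem_orthogonal]
  intro w hw
  by_cases hc : c = 0
  · have h0 : A (B w) = 0 := by
      have := Module.End.mem_eigenspace_iff.1 hw
      rw [hc, zero_smul] at this
      exact this
    have hBw : B w = 0 := by
      rw [← inner_self_eq_zero (𝕜 := ℂ), ContinuousLinearMap.adjoint_inner_left, h0,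
        inner_zero_right]
    rw [← hAτ, ← map_sub, ← ContinuousLinearMap.adjoint_inner_left]
    change inner ℂ (B w) _ = 0
    rw [hBw, inner_zero_left]
  · have h1 := key c hc w hw
    have h2 : τ (-a) w = w := by
      conv_lhs => rw [← h1]
      rw [← hτ, neg_add_cancel, hτ0]
    rw [inner_sub_right, hadj', h2, sub_self]

/-- The operator `f ↦ (x ↦ ⟪F x, f⟫)`. -/
noncomputable def innerOperator {X E : Type*} [TopologicalSpace X] [CompactSpace X]
    [NormedAddCommGroup E] [InnerProductSpace ℂ E] (F : C(X, E)) :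
    E →L[ℂ] BoundedContinuousFunction X ℂ :=
  LinearMap.mkContinuous
    { toFun := fun f => BoundedContinuousFunction.mkOfCompact
        ⟨fun x => inner ℂ (F x) f, F.continuous.inner continuous_const⟩
      map_add' := fun f g => by ext x; simp
      map_smul' := fun c f => by ext x; simp } ‖F‖ (by
    intro f
    refine (BoundedContinuousFunction.norm_le (by positivity)).2 fun x => ?_
    exact (norm_inner_le_norm _ _).trans (by gcongr; exact F.norm_coe_le_norm x))

/-- Arzelà–Ascoli: the images of the unit ball share the modulus of continuity of `F`. -/
theorem isCompactOperator_innerOperator {X E : Type*} [TopologicalSpace X] [CompactSpace X]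
    [NormedAddCommGroup E] [InnerProductSpace ℂ E] (F : C(X, E)) :
    IsCompactOperator (innerOperator F) := by
  refine (isCompactOperator_iff_isCompact_closure_image_closedBall
    (innerOperator F).toLinearMap one_pos).2 ?_
  refine BoundedContinuousFunction.arzela_ascoli (Metric.closedBall 0 ‖F‖)
    (isCompact_closedBall _ _) _ ?_ ?_
  · rintro _ x ⟨f, hf, rfl⟩
    rw [mem_closedBall_zero_iff] at hf ⊢
    refine (norm_inner_le_norm (F x) f).trans ?_
    calc ‖F x‖ * ‖f‖ ≤ ‖F‖ * 1 := by gcongr; exact F.norm_coe_le_norm x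
      _ = ‖F‖ := mul_one _
  · intro x
    rw [Metric.equicontinuousAt_iff_right]
    intro ε hε
    have := Metric.tendsto_nhds.1 (F.continuous.tendsto x) ε hε
    filter_upwards [this] with y hy
    rintro ⟨_, f, hf, rfl⟩
    rw [mem_closedBall_zero_iff] at hf
    change dist (inner ℂ (F x) f) (inner ℂ (F y) f) < ε
    rw [dist_eq_norm, ← inner_sub_left]
    refine (norm_inner_le_norm _ _).trans_lt ?_
    calc ‖F x - F y‖ * ‖f‖ ≤ ‖F x - F y‖ * 1 := by gcongr
      _ = dist (F y) (F x) := by rw [mul_one, dist_comm, dist_eq_norm]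
      _ < ε := hy

/-! ### Characters separate points -/

section Characters

open MeasureTheory

/-- Convolution-type operators on `L²` of Haar measure are compact and commute with translations;
the eigenvalues of a common eigenvector form the character. -/
theorem exists_circle_character_ne_one {X : Type*} [AddCommGroup X] [TopologicalSpace X]
    [IsTopologicalAddGroup X] [CompactSpace X] [T2Space X] {a : X} (ha : a ≠ 0) :
    ∃ χ : X → Circle, Continuous χ ∧ (∀ x y, χ (x + y) = χ x * χ y) ∧ χ a ≠ 1 := by
  borelize X
  let μ : Measure X := Measure.addHaar
  let τ : X → Lp ℂ 2 μ →ₗᵢ[ℂ] Lp ℂ 2 μ := fun b =>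
    Lp.compMeasurePreservingₗᵢ ℂ (fun x => x + b) (measurePreserving_add_right μ b)
  let J : C(X, ℂ) →L[ℂ] Lp ℂ 2 μ := ContinuousMap.toLp 2 μ ℂ
  have hJinj : Function.Injective J := ContinuousMap.toLp_injective μ
  have hJτ : ∀ (b : X) (c c' : C(X, ℂ)), (∀ x, c' x = c (x + b)) → τ b (J c) = J c' := by
    intro b c c' h
    refine Lp.ext ?_
    refine (Lp.coeFn_compMeasurePreserving _ (measurePreserving_add_right μ b)).trans ?_
    have h1 := (measurePreserving_add_right μ b).quasiMeasurePreserving.ae_eq_comp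
      (ContinuousMap.coeFn_toLp (p := 2) (𝕜 := ℂ) μ c)
    refine h1.trans ?_
    refine Filter.EventuallyEq.trans ?_ (ContinuousMap.coeFn_toLp (p := 2) (𝕜 := ℂ) μ c').symm
    exact Filter.Eventually.of_forall fun x => (h x).symm
  have hτ0 : ∀ f, τ 0 f = f := by
    intro f
    refine Lp.ext ?_
    refine (Lp.coeFn_compMeasurePreserving _ (measurePreserving_add_right μ 0)).trans ?_
    exact Filter.Eventually.of_forall fun x => by simp
  have hτ : ∀ b b' f, τ (b + b') f = τ b (τ b' f) := by
    intro b b' f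
    refine Lp.ext ?_
    refine (Lp.coeFn_compMeasurePreserving _ (measurePreserving_add_right μ _)).trans ?_
    refine Filter.EventuallyEq.symm ?_
    refine (Lp.coeFn_compMeasurePreserving _ (measurePreserving_add_right μ b)).trans ?_
    have h1 := (measurePreserving_add_right μ b).quasiMeasurePreserving.ae_eq_comp
      (Lp.coeFn_compMeasurePreserving f (measurePreserving_add_right μ b'))
    refine h1.trans ?_
    exact Filter.Eventually.of_forall fun x => by simp [add_assoc]
  -- A Urysohn function with `k 0 = 1` and `k a = 0` ensures that translation by `a` acts
  -- nontrivially on the range of the operator with kernel `k (x - y)`.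
  obtain ⟨k, hk0, hk1, -⟩ := exists_continuous_zero_one_of_isClosed
    (isClosed_singleton (x := a)) (isClosed_singleton (x := (0 : X))) (by simpa using ha)
  have hka : k a = 0 := hk0 rfl
  have hkz : k 0 = 1 := hk1 rfl
  let K : C(X, C(X, ℂ)) := ContinuousMap.curry ⟨fun p : X × X => (k (p.1 - p.2) : ℂ), by fun_prop⟩
  have hK : ∀ x y, K x y = (k (x - y) : ℂ) := fun x y => rfl
  let F : C(X, Lp ℂ 2 μ) := ⟨fun x => J (K x), J.continuous.comp K.continuous⟩
  have hFτ : ∀ b x, τ b (F (x + b)) = F x := fun b x =>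
    hJτ b _ _ fun y => by rw [hK, hK, add_sub_add_right_eq_sub]
  let S := innerOperator F
  have hS : ∀ f x, S f x = inner ℂ (F x) f := fun f x => rfl
  let I : BoundedContinuousFunction X ℂ →L[ℂ] Lp ℂ 2 μ := BoundedContinuousFunction.toLp 2 μ ℂ
  have hIJ : ∀ f : BoundedContinuousFunction X ℂ, I f = J f.toContinuousMap := fun f => rfl
  let A : Lp ℂ 2 μ →L[ℂ] Lp ℂ 2 μ := I ∘L S
  have hAc : IsCompactOperator A := (isCompactOperator_innerOperator F).clm_comp I
  have hSτ : ∀ b f x, S (τ b f) x = S f (x + b) := by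
    intro b f x
    rw [hS, hS, ← hFτ b x, (τ b).inner_map_map]
  have hAJ : ∀ f, A f = J (S f).toContinuousMap := fun f => rfl
  have hAτ : ∀ b f, A (τ b f) = τ b (A f) := by
    intro b f
    rw [hAJ, hAJ]
    exact (hJτ b _ _ fun x => hSτ b f x).symm
  have hne : ∃ f, τ a (A f) ≠ A f := by
    by_contra! hcon
    have h1 : ∀ f, inner ℂ (F (0 + a)) f = inner ℂ (F 0) f := by
      intro f
      have h2 := hcon f
      rw [← hAτ, hAJ, hAJ] at h2
      have h3 := congrArg (fun c : C(X, ℂ) => c 0) (hJinj h2)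
      have h4 : S (τ a f) 0 = S f 0 := h3
      rw [hSτ] at h4
      exact h4
    have h2 : F (0 + a) = F 0 := ext_inner_right ℂ h1
    have h3 := congrArg (fun c : C(X, ℂ) => c 0) (hJinj h2)
    simp only [hK, zero_add, sub_zero, hka, hkz] at h3
    norm_num at h3
  obtain ⟨g, hg0, χ, hχ, hχa⟩ := exists_eigenvector_of_isCompactOperator τ hτ0 hτ A hAc hAτ a hne
  -- Being in the range of `A`, the eigenvector has a continuous representative, so the eigenvalue
  -- equation holds at every point and exhibits `χ` as a quotient of continuous functions.
  let c : C(X, ℂ) := (S g).toContinuousMap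
  have hc : ∀ x b, c (x + b) = χ b * c x := by
    intro x b
    let c' : C(X, ℂ) := ⟨fun x => c (x + b), by fun_prop⟩
    have h1 : J c' = J (χ b • c) := by
      rw [← hJτ b c c' fun x => rfl, map_smul]
      exact hχ b
    exact congrArg (fun c : C(X, ℂ) => c x) (hJinj h1)
  obtain ⟨x₀, hx₀⟩ : ∃ x, c x ≠ 0 := by
    by_contra! h
    apply hg0
    have : c = 0 := ContinuousMap.ext h
    rw [hAJ]
    change J c = 0
    rw [this, map_zero]
  have hχeq : ∀ b, χ b = c (x₀ + b) / c x₀ := fun b => by rw [hc]; field_simp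
  have hχnorm : ∀ b, ‖χ b‖ = 1 := by
    intro b
    have h1 := (τ b).norm_map (A g)
    rw [hχ, norm_smul] at h1
    exact (mul_eq_right₀ (norm_ne_zero_iff.2 hg0)).1 h1
  have hχcont : Continuous χ := by
    rw [funext hχeq]
    fun_prop
  refine ⟨fun b => ⟨χ b, mem_sphere_zero_iff_norm.2 (hχnorm b)⟩, hχcont.subtype_mk _, ?_, ?_⟩
  · intro b b'
    refine Subtype.ext ?_
    change χ (b + b') = χ b * χ b'
    rw [hχeq (b + b'), ← add_assoc, hc, hc]
    field_simp
  · intro h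
    exact hχa (congrArg Subtype.val h)

/-- Continuous characters separate the points of a compact Hausdorff abelian group. -/
theorem exists_character_ne_zero {X : Type*} [AddCommGroup X] [TopologicalSpace X]
    [IsTopologicalAddGroup X] [CompactSpace X] [T2Space X] {a : X} (ha : a ≠ 0) :
    ∃ χ : X →ₜ+ UnitAddCircle, χ a ≠ 0 := by
  obtain ⟨χ, hχc, hχ, hχa⟩ := exists_circle_character_ne_one ha
  let e := AddCircle.homeomorphCircle (one_ne_zero (α := ℝ))
  have he : ∀ x y, e (x + y) = e x * e y := fun x y => by
    simp [e, AddCircle.homeomorphCircle_apply, AddCircle.toCircle_add]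
  have he0 : e 0 = 1 := by simp [e, AddCircle.homeomorphCircle_apply]
  refine ⟨⟨AddMonoidHom.mk' (fun x => e.symm (χ x)) fun x y => ?_, ?_⟩, ?_⟩
  · apply e.injective
    rw [he, e.apply_symm_apply, e.apply_symm_apply, e.apply_symm_apply, hχ]
  · exact e.symm.continuous.comp hχc
  · intro h
    apply hχa
    have h1 : e.symm (χ a) = 0 := h
    rw [← he0, ← h1, e.apply_symm_apply]

end Characters

/-! ### Pontryagin duality for compact groups -/

section Duality

open MeasureTheory

variable {X : Type*} [AddCommGroup X] [TopologicalSpace X]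

/-- A character of `X`, as a continuous complex-valued function. -/
noncomputable def characterMap (χ : X →ₜ+ UnitAddCircle) : C(X, ℂ) :=
  ⟨fun x => (AddCircle.toCircle (χ x) : ℂ),
    continuous_subtype_val.comp (AddCircle.continuous_toCircle.comp χ.continuous_toFun)⟩

theorem characterMap_apply (χ : X →ₜ+ UnitAddCircle) (x : X) :
    characterMap χ x = (AddCircle.toCircle (χ x) : ℂ) := rfl

theorem characterMap_add (χ ψ : X →ₜ+ UnitAddCircle) :
    characterMap (χ + ψ) = characterMap χ * characterMap ψ := by
  ext x
  rw [ContinuousMap.mul_apply, characterMap_apply, characterMap_apply, characterMap_apply,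
    ContinuousAddMonoidHom.add_apply, AddCircle.toCircle_add, Circle.coe_mul]

theorem characterMap_zero : characterMap (0 : X →ₜ+ UnitAddCircle) = 1 := by
  ext x
  have : (0 : X →ₜ+ UnitAddCircle) x = 0 := rfl
  rw [characterMap_apply, this, AddCircle.toCircle_zero]
  rfl

theorem characterMap_neg (χ : X →ₜ+ UnitAddCircle) :
    characterMap (-χ) = star (characterMap χ) := by
  ext x
  have : (-χ) x = - χ x := rfl
  rw [ContinuousMap.star_apply, characterMap_apply, characterMap_apply, this,
    AddCircle.toCircle_neg, Circle.coe_inv_eq_conj]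
  rfl

/-- Translation by a point where `χ` is nontrivial multiplies the invariant integral by a number
other than 1. -/
theorem integral_characterMap_eq_zero [IsTopologicalAddGroup X] [MeasurableSpace X]
    [BorelSpace X] (μ : Measure X) [μ.IsAddRightInvariant] {χ : X →ₜ+ UnitAddCircle} (hχ : χ ≠ 0) :
    ∫ x, characterMap χ x ∂μ = 0 := by
  obtain ⟨a, ha⟩ : ∃ a, χ a ≠ 0 := by
    by_contra! h
    exact hχ (ContinuousAddMonoidHom.ext h)
  have h1 : ∫ x, characterMap χ (x + a) ∂μ = ∫ x, characterMap χ x ∂μ :=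
    integral_add_right_eq_self (fun x => characterMap χ x) a
  have h2 : ∀ x, characterMap χ (x + a) = characterMap χ a * characterMap χ x := by
    intro x
    rw [characterMap_apply, characterMap_apply, characterMap_apply, map_add,
      AddCircle.toCircle_add, Circle.coe_mul, mul_comm]
  simp_rw [h2] at h1
  rw [integral_const_mul] at h1
  have h3 : (characterMap χ a - 1) * ∫ x, characterMap χ x ∂μ = 0 := by
    rw [sub_mul, h1, one_mul, sub_self]
  refine (mul_eq_zero.1 h3).resolve_left fun h => ha ?_
  have h4 : AddCircle.toCircle (χ a) = AddCircle.toCircle (0 : UnitAddCircle) := by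
    rw [AddCircle.toCircle_zero]
    exact Subtype.ext (sub_eq_zero.1 h)
  exact AddCircle.injective_toCircle one_ne_zero h4

/-- A group of characters that separates points contains all characters. -/
theorem eq_top_of_separates [IsTopologicalAddGroup X] [CompactSpace X] [T2Space X]
    (W : AddSubgroup (X →ₜ+ UnitAddCircle))
    (hW : ∀ x : X, x ≠ 0 → ∃ χ ∈ W, χ x ≠ 0) : W = ⊤ := by
  rw [AddSubgroup.eq_top_iff']
  intro χ
  by_contra hχ
  borelize X
  let μ : Measure X := Measure.addHaar
  let J : C(X, ℂ) →L[ℂ] Lp ℂ 2 μ := ContinuousMap.toLp 2 μ ℂ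
  have hJ : ∀ ψ : X →ₜ+ UnitAddCircle, inner ℂ (J (characterMap χ)) (J (characterMap ψ)) =
      ∫ x, characterMap (ψ - χ) x ∂μ := by
    intro ψ
    rw [ContinuousMap.inner_toLp]
    congr 1
    ext x
    rw [sub_eq_add_neg, characterMap_add, characterMap_neg]
    rfl
  -- The span of the characters in `W` is a separating star-subalgebra, dense by Stone–Weierstrass.
  -- A character outside `W` is orthogonal to it, hence to itself.
  let P : Submonoid C(X, ℂ) :=
    { carrier := characterMap '' W
      one_mem' := ⟨0, W.zero_mem, characterMap_zero⟩
      mul_mem' := by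
        rintro _ _ ⟨a, ha, rfl⟩ ⟨b, hb, rfl⟩
        exact ⟨a + b, W.add_mem ha hb, characterMap_add a b⟩ }
  let B : StarSubalgebra ℂ C(X, ℂ) :=
    { toSubalgebra := Algebra.adjoin ℂ (P : Set C(X, ℂ))
      star_mem' := by
        change Algebra.adjoin ℂ (P : Set C(X, ℂ)) ≤ star (Algebra.adjoin ℂ (P : Set C(X, ℂ)))
        refine Algebra.adjoin_le ?_
        rintro _ ⟨a, ha, rfl⟩
        exact Algebra.subset_adjoin ⟨-a, W.neg_mem ha, characterMap_neg a⟩ }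
  have hsep : B.SeparatesPoints := by
    intro x y hxy
    obtain ⟨ψ, hψ, hne⟩ := hW (x - y) (sub_ne_zero.2 hxy)
    refine ⟨_, ⟨characterMap ψ, Algebra.subset_adjoin ⟨ψ, hψ, rfl⟩, rfl⟩, fun h => hne ?_⟩
    rw [map_sub, sub_eq_zero]
    exact AddCircle.injective_toCircle one_ne_zero (Subtype.ext h)
  have htop := ContinuousMap.starSubalgebra_topologicalClosure_eq_top_of_separatesPoints B hsep
  have hclosed : IsClosed {f : C(X, ℂ) | inner ℂ (J (characterMap χ)) (J f) = 0} :=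
    isClosed_eq (continuous_const.inner J.continuous) continuous_const
  have hB : (B : Set C(X, ℂ)) ⊆ {f : C(X, ℂ) | inner ℂ (J (characterMap χ)) (J f) = 0} := by
    intro f hf
    have hf1 : f ∈ Subalgebra.toSubmodule (Algebra.adjoin ℂ (P : Set C(X, ℂ))) := hf
    rw [Algebra.adjoin_eq_span, Submonoid.closure_eq] at hf1
    change inner ℂ (J (characterMap χ)) (J f) = 0
    clear hf
    induction hf1 using Submodule.span_induction with
    | mem f hf =>
      obtain ⟨ψ, hψ, rfl⟩ := hf
      rw [hJ]
      refine integral_characterMap_eq_zero μ fun h => hχ ?_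
      rw [← sub_eq_zero.1 h]
      exact hψ
    | zero => simp
    | add f g _ _ hf hg => rw [map_add, inner_add_right, hf, hg, add_zero]
    | smul c f _ hf => rw [map_smul, inner_smul_right, hf, mul_zero]
  have hmem : characterMap χ ∈ closure (B : Set C(X, ℂ)) := by
    rw [← StarSubalgebra.topologicalClosure_coe, htop]
    trivial
  have h0 : inner ℂ (J (characterMap χ)) (J (characterMap χ)) = 0 :=
    closure_minimal hB hclosed hmem
  rw [hJ, sub_self, characterMap_zero] at h0
  simp [Measure.real, ENNReal.toReal_eq_zero_iff] at h0
  exact NeZero.ne μ h0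

/-- The image of `X` in the torus indexed by `s` is a closed subgroup. If it missed the prescribed
point `t`, a character of the torus would kill the image but not `t`. The characters compatible with
`ψ` at `t` include the coordinates, hence are all characters, which is a contradiction. -/
theorem exists_forall_mem_finset_apply_eq [CompactSpace X] [T2Space X]
    (ψ : (X →ₜ+ UnitAddCircle) →+ UnitAddCircle) (s : Finset (X →ₜ+ UnitAddCircle)) :
    ∃ x : X, ∀ χ ∈ s, χ x = ψ χ := by
  let Φ : X →ₜ+ (s → UnitAddCircle) :=
    ⟨AddMonoidHom.mk' (fun x χ => (χ : X →ₜ+ UnitAddCircle) x)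
      fun x y => funext fun χ => map_add (χ : X →ₜ+ UnitAddCircle) x y,
      continuous_pi fun χ => (χ : X →ₜ+ UnitAddCircle).continuous_toFun⟩
  have hΦ : ∀ x χ, Φ x χ = (χ : X →ₜ+ UnitAddCircle) x := fun x χ => rfl
  let I : AddSubgroup (s → UnitAddCircle) := Φ.toAddMonoidHom.range
  have hI : IsClosed (I : Set (s → UnitAddCircle)) :=
    (isCompact_range Φ.continuous_toFun).isClosed
  let t : s → UnitAddCircle := fun χ => ψ χ
  by_cases ht : t ∈ I
  · obtain ⟨x, hx⟩ := ht
    exact ⟨x, fun χ hχ => congrFun hx ⟨χ, hχ⟩⟩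
  exfalso
  have : T2Space ((s → UnitAddCircle) ⧸ I) := by
    have : IsClosed (I : Set (s → UnitAddCircle)) := hI
    infer_instance
  obtain ⟨η, hη⟩ := exists_character_ne_zero (X := (s → UnitAddCircle) ⧸ I)
    (a := (t : (s → UnitAddCircle) ⧸ I)) (by rwa [Ne, QuotientAddGroup.eq_zero_iff])
  let κ : (s → UnitAddCircle) →ₜ+ UnitAddCircle :=
    η.comp ⟨QuotientAddGroup.mk' I, QuotientAddGroup.continuous_mk⟩
  let W : AddSubgroup ((s → UnitAddCircle) →ₜ+ UnitAddCircle) :=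
    { carrier := {χ | ψ (χ.comp Φ) = χ t}
      zero_mem' := map_zero ψ
      add_mem' := fun {a b} ha hb => by
        change ψ (a.comp Φ + b.comp Φ) = a t + b t
        rw [map_add]
        exact congrArg₂ _ ha hb
      neg_mem' := fun {a} ha => by
        change ψ (-a.comp Φ) = - a t
        rw [map_neg]
        exact congrArg _ ha }
  have hW : W = ⊤ := by
    refine eq_top_of_separates W fun y hy => ?_
    obtain ⟨χ, hχ⟩ := Function.ne_iff.1 hy
    exact ⟨⟨Pi.evalAddMonoidHom _ χ, continuous_apply χ⟩, rfl, hχ⟩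
  have h1 : ψ (κ.comp Φ) = κ t := by
    have : κ ∈ W := hW ▸ AddSubgroup.mem_top κ
    exact this
  have h2 : κ.comp Φ = 0 := by
    refine ContinuousAddMonoidHom.ext fun x => ?_
    have : ((Φ x : s → UnitAddCircle) : (s → UnitAddCircle) ⧸ I) = 0 :=
      (QuotientAddGroup.eq_zero_iff _).2 ⟨x, rfl⟩
    change η ((Φ x : s → UnitAddCircle) : (s → UnitAddCircle) ⧸ I) = 0
    rw [this, map_zero]
  rw [h2, map_zero] at h1
  exact hη h1.symm

/-- Every homomorphism from the group of characters to the circle is the evaluation at a point. -/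
theorem exists_forall_apply_eq [CompactSpace X] [T2Space X]
    (ψ : (X →ₜ+ UnitAddCircle) →+ UnitAddCircle) :
    ∃ x : X, ∀ χ, χ x = ψ χ := by
  obtain ⟨x, hx⟩ := CompactSpace.iInter_nonempty
    (t := fun χ : X →ₜ+ UnitAddCircle => {x : X | χ x = ψ χ})
    (fun χ => isClosed_eq χ.continuous_toFun continuous_const) (fun s => by
      obtain ⟨x, hx⟩ := exists_forall_mem_finset_apply_eq ψ s
      exact ⟨x, Set.mem_iInter₂.2 hx⟩)
  exact ⟨x, fun χ => Set.mem_iInter.1 hx χ⟩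

end Duality

/-! ### Height filtration and `ℓ¹`-norm on the group ring -/

section GroupRing

variable {G : Type*} [AddCommGroup G]

/-- The elements of a group ring whose support has height at most `c`. -/
def heightLE (k : Type*) [Ring k] (ht : G →+ ℝ) (c : ℝ) : AddSubgroup (AddMonoidAlgebra k G) where
  carrier := {f | ∀ n, f.coeff n ≠ 0 → ht n ≤ c}
  zero_mem' := fun n hn => absurd rfl hn
  add_mem' := fun {f g} hf hg n hn => by
    by_cases h : f.coeff n = 0
    · refine hg n fun h' => hn ?_
      rw [AddMonoidAlgebra.coeff_add, Finsupp.add_apply, h, h', add_zero]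
    · exact hf n h
  neg_mem' := fun {f} hf n hn => hf n fun h => hn (by
    rw [AddMonoidAlgebra.coeff_neg, Finsupp.neg_apply, h, neg_zero])

theorem heightLE_mono {k : Type*} [Ring k] {ht : G →+ ℝ} {c c' : ℝ} (h : c ≤ c')
    {f : AddMonoidAlgebra k G} (hf : f ∈ heightLE k ht c) : f ∈ heightLE k ht c' :=
  fun n hn => (hf n hn).trans h

theorem single_mem_heightLE {k : Type*} [Ring k] {ht : G →+ ℝ} {c : ℝ} {n : G} (h : ht n ≤ c)
    (a : k) : AddMonoidAlgebra.single n a ∈ heightLE k ht c := by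
  intro m hm
  rw [AddMonoidAlgebra.coeff_single] at hm
  by_cases hmn : n = m
  · exact hmn ▸ h
  · exact absurd (Finsupp.single_eq_of_ne (Ne.symm hmn)) hm

theorem mul_mem_heightLE {k : Type*} [Ring k] {ht : G →+ ℝ} {a b : ℝ}
    {f g : AddMonoidAlgebra k G} (hf : f ∈ heightLE k ht a) (hg : g ∈ heightLE k ht b) :
    f * g ∈ heightLE k ht (a + b) := by
  classical
  intro n hn
  have h1 := AddMonoidAlgebra.support_coeff_mul_subset f g (Finsupp.mem_support_iff.2 hn)
  obtain ⟨m, hm, m', hm', rfl⟩ := Finset.mem_add.1 h1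
  rw [map_add]
  exact add_le_add (hf m (Finsupp.mem_support_iff.1 hm)) (hg m' (Finsupp.mem_support_iff.1 hm'))

theorem one_mem_heightLE {k : Type*} [Ring k] (ht : G →+ ℝ) :
    (1 : AddMonoidAlgebra k G) ∈ heightLE k ht 0 := by
  rw [AddMonoidAlgebra.one_def]
  exact single_mem_heightLE (by simp) 1

theorem pow_mem_heightLE {k : Type*} [Ring k] {ht : G →+ ℝ} {a : ℝ}
    {f : AddMonoidAlgebra k G} (hf : f ∈ heightLE k ht a) (j : ℕ) :
    f ^ j ∈ heightLE k ht (j * a) := by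
  induction j with
  | zero => simpa using one_mem_heightLE ht
  | succ j ih =>
    rw [pow_succ, Nat.cast_succ, add_mul, one_mul]
    exact mul_mem_heightLE ih hf

theorem exists_mem_heightLE {k : Type*} [Ring k] (ht : G →+ ℝ) (f : AddMonoidAlgebra k G) :
    ∃ c, f ∈ heightLE k ht c := by
  obtain ⟨c, hc⟩ := (f.coeff.support.image ht).bddAbove
  exact ⟨c, fun n hn => hc (Finset.mem_coe.2
    (Finset.mem_image_of_mem ht (Finsupp.mem_support_iff.2 hn)))⟩

/-- The subring of the group ring supported on the half-space of non-positive height. -/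
def halfRing (k : Type*) [Ring k] (ht : G →+ ℝ) : Subring (AddMonoidAlgebra k G) where
  __ := heightLE k ht 0
  one_mem' := one_mem_heightLE ht
  mul_mem' := fun hf hg => by simpa using mul_mem_heightLE hf hg

theorem l1_sum_add_le (f g : AddMonoidAlgebra ℝ G) :
    ((f + g).coeff.sum fun _ c => |c|) ≤
      (f.coeff.sum fun _ c => |c|) + g.coeff.sum fun _ c => |c| := by
  classical
  have h : ∀ u : AddMonoidAlgebra ℝ G, u.coeff.support ⊆ f.coeff.support ∪ g.coeff.support →
      (u.coeff.sum fun _ c => |c|) = ∑ n ∈ f.coeff.support ∪ g.coeff.support, |u.coeff n| :=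
    fun u hu => Finsupp.sum_of_support_subset _ hu _ (by simp)
  rw [h (f + g) Finsupp.support_add, h f Finset.subset_union_left,
    h g Finset.subset_union_right, ← Finset.sum_add_distrib]
  exact Finset.sum_le_sum fun n _ => abs_add_le _ _

/-- The `ℓ¹`-norm on the real group ring. -/
noncomputable def l1RingNorm (G : Type*) [AddCommGroup G] : RingNorm (AddMonoidAlgebra ℝ G) where
  toFun f := f.coeff.sum fun _ c => |c|
  map_zero' := by simp
  add_le' := l1_sum_add_le
  neg' f := by
    rw [AddMonoidAlgebra.coeff_neg, Finsupp.sum_neg_index (by simp)]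
    simp
  mul_le' f g := by
    rw [AddMonoidAlgebra.mul_def]
    refine (Finset.le_sum_of_subadditive (fun u : AddMonoidAlgebra ℝ G =>
      u.coeff.sum fun _ c => |c|) (by simp) l1_sum_add_le _ _).trans ?_
    rw [Finsupp.sum, Finset.sum_mul]
    refine Finset.sum_le_sum fun m _ => ?_
    refine (Finset.le_sum_of_subadditive (fun u : AddMonoidAlgebra ℝ G =>
      u.coeff.sum fun _ c => |c|) (by simp) l1_sum_add_le _ _).trans ?_
    rw [Finsupp.sum, Finset.mul_sum]
    refine Finset.sum_le_sum fun n _ => ?_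
    simp only
    rw [AddMonoidAlgebra.coeff_single, Finsupp.sum_single_index (by simp), abs_mul]
  eq_zero_of_map_eq_zero' f hf := by
    refine AddMonoidAlgebra.ext (Finsupp.ext fun n => ?_)
    by_contra hn
    have := (Finset.sum_eq_zero_iff_of_nonneg (fun _ _ => abs_nonneg _)).1 hf n
      (Finsupp.mem_support_iff.2 hn)
    exact hn (abs_eq_zero.1 this)

noncomputable instance : NormedRing (AddMonoidAlgebra ℝ G) := (l1RingNorm G).toNormedRing

theorem l1_norm_def (f : AddMonoidAlgebra ℝ G) : ‖f‖ = f.coeff.sum fun _ c => |c| := rfl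

noncomputable instance : NormedSpace ℝ (AddMonoidAlgebra ℝ G) where
  norm_smul_le a f := by
    rw [l1_norm_def, l1_norm_def, AddMonoidAlgebra.coeff_smul, Finsupp.sum_smul_index (by simp),
      Finsupp.mul_sum]
    exact le_of_eq (Finset.sum_congr rfl fun n _ => abs_mul _ _)

theorem l1_norm_single (n : G) (a : ℝ) : ‖AddMonoidAlgebra.single n a‖ = |a| := by
  rw [l1_norm_def, AddMonoidAlgebra.coeff_single, Finsupp.sum_single_index (by simp)]

end GroupRing

/-! ### Contraction of real sequences on a half-space -/

section OrbitSums

variable {G : Type*} [AddCommGroup G]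

/-- The sum `∑ m, f m * w (n + m)`, for an element `f` of the group ring. -/
noncomputable def orbitSum (w : G → ℝ) (n : G) : AddMonoidAlgebra ℝ G →+ ℝ :=
  (Finsupp.liftAddHom fun m => AddMonoidHom.mulRight (w (n + m))).comp
    AddMonoidAlgebra.coeffAddEquiv.toAddMonoidHom

theorem orbitSum_apply (w : G → ℝ) (n : G) (f : AddMonoidAlgebra ℝ G) :
    orbitSum w n f = f.coeff.sum fun m c => c * w (n + m) := rfl

theorem orbitSum_single (w : G → ℝ) (n m : G) (a : ℝ) :
    orbitSum w n (AddMonoidAlgebra.single m a) = a * w (n + m) := by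
  rw [orbitSum_apply, AddMonoidAlgebra.coeff_single, Finsupp.sum_single_index (by simp)]

theorem abs_orbitSum_le {ht : G →+ ℝ} {w : G → ℝ} {C : ℝ} (hw : ∀ n, ht n ≤ 0 → |w n| ≤ C)
    {f : AddMonoidAlgebra ℝ G} (hf : f ∈ heightLE ℝ ht 0) {n : G} (hn : ht n ≤ 0) :
    |orbitSum w n f| ≤ ‖f‖ * C := by
  rw [orbitSum_apply, l1_norm_def, Finsupp.sum, Finsupp.sum, Finset.sum_mul]
  refine (Finset.abs_sum_le_sum_abs _ _).trans (Finset.sum_le_sum fun m hm => ?_)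
  rw [abs_mul]
  gcongr
  refine hw _ ?_
  rw [map_add]
  have := hf m (Finsupp.mem_support_iff.1 hm)
  linarith

/-- Since `f` has non-positive height, the relation stays inside the half-space, and each use of it
improves the bound on `w` by the factor `‖f‖ / q < 1`. -/
theorem eq_zero_of_mul_eq_orbitSum {ht : G →+ ℝ} {w : G → ℝ} {C q : ℝ}
    (hw : ∀ n, ht n ≤ 0 → |w n| ≤ C) {f : AddMonoidAlgebra ℝ G} (hf : f ∈ heightLE ℝ ht 0)
    (hq : ‖f‖ < q) (hfw : ∀ n, ht n ≤ 0 → q * w n = orbitSum w n f) {n : G} (hn : ht n ≤ 0) :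
    w n = 0 := by
  have hq0 : 0 < q := (norm_nonneg f).trans_lt hq
  have hC : 0 ≤ C := (abs_nonneg _).trans (hw n hn)
  have key : ∀ j : ℕ, ∀ n, ht n ≤ 0 → |w n| ≤ (‖f‖ / q) ^ j * C := by
    intro j
    induction j with
    | zero => simpa using hw
    | succ j ih =>
      intro n hn
      have h1 := abs_orbitSum_le ih hf hn
      rw [← hfw n hn, abs_mul, abs_of_pos hq0] at h1
      rw [pow_succ', mul_assoc, div_mul_eq_mul_div, le_div_iff₀ hq0]
      linarith
  have hlim : Filter.Tendsto (fun j : ℕ => (‖f‖ / q) ^ j * C) Filter.atTop (nhds (0 * C)) :=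
    (tendsto_pow_atTop_nhds_zero_of_lt_one (by positivity) ((div_lt_one hq0).2 hq)).mul_const C
  rw [zero_mul] at hlim
  exact abs_nonpos_iff.1 (ge_of_tendsto' hlim fun j => key j n hn)

/-- The natural map from the integral to the real group ring. -/
noncomputable abbrev toRealRing (G : Type*) [AddCommGroup G] :
    AddMonoidAlgebra ℤ G →+* AddMonoidAlgebra ℝ G :=
  AddMonoidAlgebra.mapRingHom G (Int.castRingHom ℝ)

theorem toRealRing_mem_heightLE {ht : G →+ ℝ} {c : ℝ} {f : AddMonoidAlgebra ℤ G}
    (hf : f ∈ heightLE ℤ ht c) : toRealRing G f ∈ heightLE ℝ ht c := by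
  intro n hn
  refine hf n fun h => hn ?_
  rw [AddMonoidAlgebra.coeff_mapRingHom, h, map_zero]

theorem UnitAddCircle.exists_abs_eq_norm (t : UnitAddCircle) :
    ∃ r : ℝ, (r : UnitAddCircle) = t ∧ |r| = ‖t‖ := by
  obtain ⟨x, rfl⟩ := QuotientAddGroup.mk_surjective t
  refine ⟨x - round x, ?_, (UnitAddCircle.norm_eq).symm⟩
  have h : ((round x : ℝ) : UnitAddCircle) = 0 := by
    rw [AddCircle.coe_eq_zero_iff]
    exact ⟨round x, by simp⟩
  rw [AddCircle.coe_sub, h, sub_zero]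

theorem UnitAddCircle.eq_zero_of_abs_lt_one {x : ℝ} (hx : (x : UnitAddCircle) = 0)
    (h : |x| < 1) : x = 0 := by
  obtain ⟨n, rfl⟩ := (AddCircle.coe_eq_zero_iff (1 : ℝ)).1 hx
  simp only [zsmul_eq_mul, mul_one] at h ⊢
  have : |n| < 1 := by exact_mod_cast h
  rw [Int.abs_lt_one_iff.1 this, Int.cast_zero]

end OrbitSums

/-! ### Contracted modules and the dual module -/

/-- A module over the integral group ring is contracted by the half-space of non-positive height
if it is finitely generated, some element of negative height acts as the identity, and some
element `p` of non-positive height acts as an integer exceeding the `ℓ¹`-norm of `p`. -/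
def HalfSpaceContracted {G : Type*} [AddCommGroup G] (ht : G →+ ℝ) (M : Type*) [AddCommGroup M]
    [Module (AddMonoidAlgebra ℤ G) M] : Prop :=
  Module.Finite (AddMonoidAlgebra ℤ G) M ∧
  (∃ η : ℝ, 0 < η ∧ ∃ h ∈ heightLE ℤ ht (-η), ∀ m : M, h • m = m) ∧
  ∃ q : ℕ, ∃ p ∈ heightLE ℤ ht 0, ‖toRealRing G p‖ < q ∧ ∀ m : M, p • m = q • m

theorem HalfSpaceContracted.of_injective {d : ℕ} {ht : (Fin d → ℤ) →+ ℝ} {M N : Type*}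
    [AddCommGroup M] [Module (AddMonoidAlgebra ℤ (Fin d → ℤ)) M] [AddCommGroup N]
    [Module (AddMonoidAlgebra ℤ (Fin d → ℤ)) N] (hM : HalfSpaceContracted ht M)
    (f : N →ₗ[AddMonoidAlgebra ℤ (Fin d → ℤ)] M) (hf : Function.Injective f) :
    HalfSpaceContracted ht N := by
  obtain ⟨hfin, ⟨η, hη, h, hh, hid⟩, q, p, hp, hpq, hpid⟩ := hM
  refine ⟨?_, ⟨η, hη, h, hh, fun m => hf ?_⟩, q, p, hp, hpq, fun m => hf ?_⟩
  · have : IsNoetherianRing (AddMonoidAlgebra ℤ (Fin d → ℤ)) :=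
      Algebra.FiniteType.isNoetherianRing ℤ _
    exact Module.Finite.of_injective f hf
  · rw [map_smul, hid]
  · rw [map_smul, map_nsmul, hpid]

namespace AlgebraicZdAction

variable {d : ℕ} {X : Type*} [AddCommGroup X] [TopologicalSpace X]

/-- The dual group of `X`, as a module over the group ring of `ℤ^d`. -/
def DualModule (_ : AlgebraicZdAction d X) : Type _ := X →ₜ+ UnitAddCircle

noncomputable instance (α : AlgebraicZdAction d X) : AddCommGroup α.DualModule :=
  inferInstanceAs (AddCommGroup (X →ₜ+ UnitAddCircle))

instance (α : AlgebraicZdAction d X) : FunLike α.DualModule X UnitAddCircle :=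
  inferInstanceAs (FunLike (X →ₜ+ UnitAddCircle) X UnitAddCircle)

instance (α : AlgebraicZdAction d X) : AddMonoidHomClass α.DualModule X UnitAddCircle :=
  inferInstanceAs (AddMonoidHomClass (X →ₜ+ UnitAddCircle) X UnitAddCircle)

instance (α : AlgebraicZdAction d X) : ContinuousMapClass α.DualModule X UnitAddCircle :=
  inferInstanceAs (ContinuousMapClass (X →ₜ+ UnitAddCircle) X UnitAddCircle)

theorem action_mul_apply (α : AlgebraicZdAction d X) (m n : Multiplicative (Fin d → ℤ)) (x : X) :
    α.action (m * n) x = α.action m (α.action n x) := by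
  rw [map_mul]
  rfl

theorem action_one_apply (α : AlgebraicZdAction d X) (x : X) : α.action 1 x = x := by
  rw [map_one]
  rfl

theorem DualModule.ext {α : AlgebraicZdAction d X} {χ ψ : α.DualModule} (h : ∀ x, χ x = ψ x) :
    χ = ψ :=
  ContinuousAddMonoidHom.ext h

/-- Evaluation at a point, as a homomorphism on the dual module. -/
noncomputable def DualModule.eval (α : AlgebraicZdAction d X) (x : X) :
    α.DualModule →+ UnitAddCircle :=
  AddMonoidHom.mk' (fun χ => χ x) fun _ _ => rfl

theorem DualModule.eval_apply {α : AlgebraicZdAction d X} (χ : α.DualModule) (x : X) :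
    DualModule.eval α x χ = χ x := rfl

/-- The action of `ℤ^d` on the dual group. -/
noncomputable def dualAction (α : AlgebraicZdAction d X) :
    Multiplicative (Fin d → ℤ) →* AddMonoid.End α.DualModule where
  toFun n := AddMonoidHom.mk'
    (fun χ => ContinuousAddMonoidHom.comp (B := X) χ ⟨α.endo n, (α.action n).continuous⟩)
    fun _ _ => rfl
  map_one' := by
    refine AddMonoidHom.ext fun χ => DualModule.ext fun x => ?_
    change χ (α.action 1 x) = χ x
    rw [action_one_apply]
  map_mul' m n := by
    refine AddMonoidHom.ext fun χ => DualModule.ext fun x => ?_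
    change χ (α.action (m * n) x) = χ (α.action n (α.action m x))
    -- Pulling back reverses composition, which is harmless because `ℤ^d` is commutative.
    rw [mul_comm, action_mul_apply]

noncomputable instance (α : AlgebraicZdAction d X) :
    Module (AddMonoidAlgebra ℤ (Fin d → ℤ)) α.DualModule :=
  Module.compHom _ (AddMonoidAlgebra.lift ℤ (AddMonoid.End α.DualModule) (Fin d → ℤ)
    α.dualAction).toRingHom

theorem single_smul_apply (α : AlgebraicZdAction d X) (n : Fin d → ℤ) (a : ℤ)
    (χ : α.DualModule) (x : X) :
    (AddMonoidAlgebra.single n a • χ) x = a • χ (α.action (Multiplicative.ofAdd n) x) := by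
  change (AddMonoidAlgebra.lift ℤ (AddMonoid.End α.DualModule) (Fin d → ℤ)
    α.dualAction (AddMonoidAlgebra.single n a) χ) x = _
  rw [AddMonoidAlgebra.lift_single]
  change DualModule.eval α x (a • α.dualAction (Multiplicative.ofAdd n) χ) = _
  rw [map_zsmul]
  rfl

/-- The small half-orbits are trivial: topological form of expansiveness along a half-space. -/
def HalfExpansive (α : AlgebraicZdAction d X) (ht : (Fin d → ℤ) →+ ℝ) : Prop :=
  ∃ U ∈ nhds (0 : X), ∀ x : X,
    (∀ n, ht n ≤ 0 → α.action (Multiplicative.ofAdd n) x ∈ U) → x = 0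

/-- Transfers relations in the dual module to real lifts `w` of the character values, modulo 1. -/
theorem smul_apply_eq_orbitSum (α : AlgebraicZdAction d X) (χ : α.DualModule) (x : X)
    (w : (Fin d → ℤ) → ℝ)
    (hw : ∀ n, (w n : UnitAddCircle) = χ (α.action (Multiplicative.ofAdd n) x))
    (f : AddMonoidAlgebra ℤ (Fin d → ℤ)) (n : Fin d → ℤ) :
    (f • χ) (α.action (Multiplicative.ofAdd n) x) = (orbitSum w n (toRealRing _ f) : ℝ) := by
  induction f using AddMonoidAlgebra.induction_linear with
  | zero =>
    rw [zero_smul, map_zero, map_zero, AddCircle.coe_zero]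
    rfl
  | add f g hf hg =>
    rw [add_smul, map_add, map_add, AddCircle.coe_add, ← hf, ← hg]
    rfl
  | single m a =>
    rw [single_smul_apply, AddMonoidAlgebra.mapRingHom_single, orbitSum_single,
      ← action_mul_apply, ← ofAdd_add, ← hw, add_comm m n, ← AddCircle.coe_zsmul, zsmul_eq_mul]
    rfl

theorem smul_apply_eq_zero_of_mem_heightLE (α : AlgebraicZdAction d X) {ht : (Fin d → ℤ) →+ ℝ}
    (χ : α.DualModule) (x : X)
    (h : ∀ n, ht n ≤ 0 → χ (α.action (Multiplicative.ofAdd n) x) = 0)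
    {f : AddMonoidAlgebra ℤ (Fin d → ℤ)} (hf : f ∈ heightLE ℤ ht 0) : (f • χ) x = 0 := by
  rw [← AddMonoidAlgebra.sum_coeff_single f, Finsupp.sum, Finset.sum_smul,
    ← DualModule.eval_apply, map_sum]
  refine Finset.sum_eq_zero fun n hn => ?_
  rw [DualModule.eval_apply, single_smul_apply, h n (hf n (Finsupp.mem_support_iff.1 hn)),
    smul_zero]

theorem halfExpansive_of_halfSpaceContracted [IsTopologicalAddGroup X] [CompactSpace X]
    [T2Space X] (α : AlgebraicZdAction d X) {ht : (Fin d → ℤ) →+ ℝ}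
    (hα : HalfSpaceContracted ht α.DualModule) : α.HalfExpansive ht := by
  obtain ⟨⟨s, hs⟩, ⟨η, hη, h, hh, hid⟩, q, p, hp, hpq, hpid⟩ := hα
  -- With this `δ` both sides of `q w = p w` differ by less than 1, so the congruence modulo 1 is an
  -- equality of reals.
  obtain ⟨δ, hδ0, hδ⟩ : ∃ δ : ℝ, 0 < δ ∧ ((q : ℝ) + ‖toRealRing (Fin d → ℤ) p‖) * δ < 1 := by
    refine ⟨1 / (q + ‖toRealRing (Fin d → ℤ) p‖ + 1), by positivity, ?_⟩
    rw [mul_one_div, div_lt_one (by positivity)]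
    linarith
  refine ⟨⋂ χ ∈ s, {x | ‖χ x‖ < δ}, ?_, fun x hx => ?_⟩
  · refine (Filter.biInter_finset_mem s).2 fun χ _ => ?_
    refine IsOpen.mem_nhds (isOpen_lt (map_continuous χ).norm continuous_const) ?_
    simpa using hδ0
  have hzero : ∀ χ ∈ s, ∀ n, ht n ≤ 0 → χ (α.action (Multiplicative.ofAdd n) x) = 0 := by
    intro χ hχ
    choose w hw hwn using fun n => UnitAddCircle.exists_abs_eq_norm
      (χ (α.action (Multiplicative.ofAdd n) x))
    have hwδ : ∀ n, ht n ≤ 0 → |w n| ≤ δ := fun n hn => by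
      rw [hwn]
      exact (Set.mem_iInter₂.1 (hx n hn) χ hχ).le
    intro n hn
    rw [← hw, eq_zero_of_mul_eq_orbitSum hwδ (toRealRing_mem_heightLE hp) hpq (fun n hn => ?_) hn,
      AddCircle.coe_zero]
    rw [← sub_eq_zero]
    refine UnitAddCircle.eq_zero_of_abs_lt_one ?_ ?_
    · rw [AddCircle.coe_sub, ← smul_apply_eq_orbitSum α χ x w hw, hpid,
        ← nsmul_eq_mul, AddCircle.coe_nsmul, hw, ← DualModule.eval_apply (q • χ), map_nsmul,
        DualModule.eval_apply, sub_self]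
    · calc |q * w n - orbitSum w n (toRealRing _ p)|
          ≤ |q * w n| + |orbitSum w n (toRealRing _ p)| := abs_sub _ _
        _ ≤ q * δ + ‖toRealRing (Fin d → ℤ) p‖ * δ := by
          rw [abs_mul, Nat.abs_cast]
          gcongr
          · exact hwδ n hn
          · exact abs_orbitSum_le hwδ (toRealRing_mem_heightLE hp) hn
        _ < 1 := by rwa [← add_mul]
  have hpow : ∀ (j : ℕ) (χ : α.DualModule), h ^ j • χ = χ := by
    intro j χ
    induction j with
    | zero => rw [pow_zero, one_smul]
    | succ j ih => rw [pow_succ, mul_smul, hid, ih]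
  have hsmul : ∀ χ ∈ s, ∀ f : AddMonoidAlgebra ℤ (Fin d → ℤ), (f • χ) x = 0 := by
    intro χ hχ f
    obtain ⟨c, hc⟩ := exists_mem_heightLE ht f
    obtain ⟨j, hj⟩ := exists_nat_ge (c / η)
    -- Multiplying by `h ^ j` does not change `f • χ` but lowers the height of `f` by `j * η`, into
    -- the half-space.
    rw [← hpow j (f • χ), smul_smul]
    refine smul_apply_eq_zero_of_mem_heightLE α χ x (hzero χ hχ)
      (heightLE_mono ?_ (mul_mem_heightLE (pow_mem_heightLE hh j) hc))
    rw [div_le_iff₀ hη] at hj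
    linarith
  have hall : ∀ χ : α.DualModule, χ x = 0 := by
    intro χ
    have hχ : χ ∈ Submodule.span (AddMonoidAlgebra ℤ (Fin d → ℤ)) (s : Set α.DualModule) :=
      hs ▸ Submodule.mem_top
    obtain ⟨f, -, hf⟩ := Submodule.mem_span_finset.1 hχ
    rw [← hf, ← DualModule.eval_apply, map_sum]
    exact Finset.sum_eq_zero fun ψ hψ => hsmul ψ hψ _
  by_contra hne
  obtain ⟨χ, hχ⟩ := exists_character_ne_zero hne
  exact hχ (hall χ)

end AlgebraicZdAction

/-! ### Approximation by relations and determinants -/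

/-- A point that is not approximated by rational multiples of elements of a subgroup `L` is
separated from `L` by a continuous functional vanishing on `L`. -/
theorem exists_nat_smul_approx_or_exists_dual {E : Type*} [NormedAddCommGroup E]
    [NormedSpace ℝ E] (L : AddSubgroup E) (v : E) :
    (∀ ε : ℝ, 0 < ε → ∃ q : ℕ, 0 < q ∧ ∃ r ∈ L, ‖v - (q : ℝ)⁻¹ • r‖ < ε) ∨
      ∃ f : E →L[ℝ] ℝ, (∀ r ∈ L, f r = 0) ∧ f v ≠ 0 := by
  let V : Set E := {u | ∃ q : ℕ, 0 < q ∧ ∃ r ∈ L, u = (q : ℝ)⁻¹ • r}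
  have hVsmul : ∀ (c : ℚ), ∀ u ∈ V, (c : ℝ) • u ∈ V := by
    rintro c _ ⟨q, hq, r, hr, rfl⟩
    refine ⟨q * c.den, Nat.mul_pos hq c.pos, c.num • r, L.zsmul_mem hr _, ?_⟩
    rw [← Int.cast_smul_eq_zsmul ℝ, smul_smul, smul_smul, Rat.cast_def]
    congr 1
    push_cast
    field_simp
  have hVadd : ∀ u ∈ V, ∀ u' ∈ V, u + u' ∈ V := by
    rintro _ ⟨q, hq, r, hr, rfl⟩ _ ⟨q', hq', r', hr', rfl⟩
    refine ⟨q * q', Nat.mul_pos hq hq', q' • r + q • r',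
      L.add_mem (L.nsmul_mem hr _) (L.nsmul_mem hr' _), ?_⟩
    rw [← Nat.cast_smul_eq_nsmul ℝ, ← Nat.cast_smul_eq_nsmul ℝ, smul_add, smul_smul, smul_smul]
    have h1 : (q : ℝ) ≠ 0 := by positivity
    have h2 : (q' : ℝ) ≠ 0 := by positivity
    congr 2 <;> · push_cast; field_simp
  -- The closure of the rational span is a real subspace because `ℚ` is dense in `ℝ`.
  let W : Submodule ℝ E :=
    { carrier := closure V
      zero_mem' := subset_closure ⟨1, one_pos, 0, L.zero_mem, by simp⟩
      add_mem' := fun {a b} ha hb => map_mem_closure₂ continuous_add ha hb hVadd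
      smul_mem' := fun c u hu => by
        have hc : c ∈ closure (Set.range ((↑) : ℚ → ℝ)) := Rat.denseRange_cast c
        refine map_mem_closure₂ (f := fun (c : ℝ) (u : E) => c • u) continuous_smul hc hu ?_
        rintro _ ⟨c, rfl⟩ u hu
        exact hVsmul c u hu }
  by_cases hv : v ∈ W
  · left
    intro ε hε
    obtain ⟨_, ⟨q, hq, r, hr, rfl⟩, hd⟩ := Metric.mem_closure_iff.1 hv ε hε
    exact ⟨q, hq, r, hr, by rwa [← dist_eq_norm]⟩
  · right
    obtain ⟨f, u, hfv, hf⟩ := geometric_hahn_banach_point_closed W.convex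
      (isClosed_closure (s := V)) hv
    have hu : u < 0 := by simpa using hf 0 W.zero_mem
    refine ⟨f, fun r hr => ?_, (hfv.trans hu).ne⟩
    by_contra hne
    have hrW : r ∈ W := subset_closure ⟨1, one_pos, r, hr, by simp⟩
    -- A functional bounded below on a subspace vanishes there: this multiple of `r` takes the
    -- forbidden value `u`.
    have h1 := hf ((u / f r) • r) (W.smul_mem _ hrW)
    rw [map_smul, smul_eq_mul, div_mul_cancel₀ _ hne] at h1
    exact lt_irrefl _ h1

section GroupRing

variable {G : Type*} [AddCommGroup G]

theorem exists_norm_one_sub_det_lt (ι : Type*) [Fintype ι] [DecidableEq ι] :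
    ∃ ε : ℝ, 0 < ε ∧ ∀ B : Matrix ι ι (AddMonoidAlgebra ℝ G), (∀ i j, ‖B i j‖ < ε) →
      ‖1 - (1 - B).det‖ < 1 := by
  have hcont : Continuous fun b : ι → ι → AddMonoidAlgebra ℝ G =>
      1 - (1 - Matrix.of b : Matrix ι ι (AddMonoidAlgebra ℝ G)).det := by
    refine continuous_const.sub (Continuous.matrix_det ?_)
    exact continuous_const.sub continuous_id
  obtain ⟨ε, hε, h⟩ := Metric.continuousAt_iff.1 (hcont.continuousAt (x := 0)) 1 one_pos
  refine ⟨ε, hε, fun B hB => ?_⟩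
  have h1 : dist (fun i j => B i j) (0 : ι → ι → AddMonoidAlgebra ℝ G) < ε := by
    rw [dist_zero_right, pi_norm_lt_iff hε]
    exact fun i => (pi_norm_lt_iff hε).2 fun j => hB i j
  have h2 := h h1
  have h3 : (Matrix.of (0 : ι → ι → AddMonoidAlgebra ℝ G)) = 0 := rfl
  rw [h3, sub_zero, Matrix.det_one, sub_self, dist_zero_right] at h2
  exact h2

/-- Multiplication by a monomial of positive height satisfies a monic equation over the half-space
ring, by Cayley–Hamilton. Dividing by its leading power leaves only terms of negative height. -/
theorem exists_neg_height_smul_eq_self {ht : G →+ ℝ} {M : Type*} [AddCommGroup M]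
    [Module (AddMonoidAlgebra ℤ G) M] [Module.Finite (halfRing ℤ ht) M] {m₀ : G}
    (hm₀ : 0 < ht m₀) :
    ∃ η : ℝ, 0 < η ∧ ∃ h ∈ heightLE ℤ ht (-η), ∀ m : M, h • m = m := by
  let u : AddMonoidAlgebra ℤ G := AddMonoidAlgebra.single m₀ 1
  let F : Module.End (halfRing ℤ ht) M :=
    { toFun := fun m => u • m
      map_add' := smul_add u
      map_smul' := fun r m => smul_comm u (r : AddMonoidAlgebra ℤ G) m }
  have hF : ∀ (j : ℕ) (m : M), (F ^ j) m = u ^ j • m := by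
    intro j m
    induction j with
    | zero => rw [pow_zero, pow_zero, one_smul]; rfl
    | succ j ih => rw [pow_succ', Module.End.mul_apply, ih, pow_succ', mul_smul]; rfl
  obtain ⟨P, hP, hP0⟩ := LinearMap.exists_monic_and_aeval_eq_zero (halfRing ℤ ht) F
  let g : AddMonoidAlgebra ℤ G :=
    ∑ i ∈ Finset.range P.natDegree, (P.coeff i : AddMonoidAlgebra ℤ G) * u ^ i
  have hg : ∀ m : M, u ^ P.natDegree • m = -g • m := by
    intro m
    have h1 := congrArg (fun T : Module.End (halfRing ℤ ht) M => T m) hP0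
    simp only [Polynomial.aeval_eq_sum_range, LinearMap.sum_apply, LinearMap.smul_apply, hF,
      LinearMap.zero_apply] at h1
    rw [Finset.sum_range_succ, Polynomial.Monic.coeff_natDegree hP, one_smul] at h1
    rw [neg_smul, eq_neg_iff_add_eq_zero, add_comm, ← h1, Finset.sum_smul]
    congr 1
    exact Finset.sum_congr rfl fun i _ => mul_smul _ _ _
  let a : AddMonoidAlgebra ℤ G := AddMonoidAlgebra.single (-(P.natDegree • m₀)) 1
  have hu : ∀ j, u ^ j = AddMonoidAlgebra.single (j • m₀) 1 := fun j => by
    rw [AddMonoidAlgebra.single_pow, one_pow]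
  refine ⟨ht m₀, hm₀, a * -g, ?_, fun m => ?_⟩
  · rw [mul_neg, Finset.mul_sum]
    refine neg_mem (sum_mem fun i hi => ?_)
    rw [mul_left_comm, hu, AddMonoidAlgebra.single_mul_single]
    have h1 : AddMonoidAlgebra.single (-(P.natDegree • m₀) + i • m₀) (1 * 1 : ℤ) ∈
        heightLE ℤ ht (-ht m₀) := by
      refine single_mem_heightLE ?_ _
      rw [map_add, map_neg, map_nsmul, map_nsmul, nsmul_eq_mul, nsmul_eq_mul]
      have : (i : ℝ) + 1 ≤ P.natDegree := by exact_mod_cast Finset.mem_range.1 hi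
      nlinarith
    simpa using mul_mem_heightLE (P.coeff i).2 h1
  · rw [mul_smul, ← hg, smul_smul, hu, AddMonoidAlgebra.single_mul_single, neg_add_cancel,
      one_mul, ← AddMonoidAlgebra.one_def, one_smul]

/-- The natural map from the half-space ring to the real group ring. -/
noncomputable def halfToReal (ht : G →+ ℝ) : halfRing ℤ ht →+* AddMonoidAlgebra ℝ G :=
  (toRealRing G).comp (halfRing ℤ ht).subtype

theorem halfToReal_apply (ht : G →+ ℝ) (r : halfRing ℤ ht) :
    halfToReal ht r = toRealRing G r := rfl

/-- If the generators of a module are limits of rational multiples of relations, then some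
element of non-positive height acts as an integer exceeding its `ℓ¹`-norm. -/
theorem exists_smul_eq_nsmul_of_approx {ht : G →+ ℝ} {M ι : Type*} [Fintype ι] [DecidableEq ι]
    [AddCommGroup M] [Module (AddMonoidAlgebra ℤ G) M] (e : ι → M)
    (he : Submodule.span (halfRing ℤ ht) (Set.range e) = ⊤)
    (happ : ∀ (i : ι) (ε : ℝ), 0 < ε → ∃ q : ℕ, 0 < q ∧ ∃ r : ι → halfRing ℤ ht,
      ∑ j, r j • e j = 0 ∧
        ∀ j, ‖(Pi.single i 1 : ι → AddMonoidAlgebra ℝ G) j - (q : ℝ)⁻¹ • halfToReal ht (r j)‖ < ε) :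
    ∃ q : ℕ, ∃ p ∈ heightLE ℤ ht 0, ‖toRealRing G p‖ < q ∧ ∀ m : M, p • m = q • m := by
  obtain ⟨ε, hε, hdet⟩ := exists_norm_one_sub_det_lt (G := G) ι
  choose q hq r hr hqr using fun i => happ i ε hε
  -- The rows of `C` are relations among the generators, so its determinant annihilates the module
  -- by the adjugate identity.
  let C : Matrix ι ι (halfRing ℤ ht) := Matrix.of r
  have hC : ∀ m : M, C.det • m = 0 := by
    have h1 : ∀ i, C.det • e i = 0 := by
      intro i
      have h2 : ∀ j, (C.adjugate * C) i j = if i = j then C.det else 0 := fun j => by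
        rw [Matrix.adjugate_mul, Matrix.smul_apply, Matrix.one_apply, smul_eq_mul, mul_ite,
          mul_one, mul_zero]
      calc C.det • e i = ∑ j, (C.adjugate * C) i j • e j := by simp [h2, ite_smul]
        _ = ∑ k, C.adjugate i k • ∑ j, C k j • e j := by
          simp_rw [Matrix.mul_apply, Finset.sum_smul, Finset.smul_sum, mul_smul]
          exact Finset.sum_comm
        _ = 0 := Finset.sum_eq_zero fun k _ => by
          have h3 : ∑ j, C k j • e j = 0 := hr k
          rw [h3, smul_zero]
    intro m
    have hm : m ∈ Submodule.span (halfRing ℤ ht) (Set.range e) := he ▸ Submodule.mem_top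
    induction hm using Submodule.span_induction with
    | mem x hx => obtain ⟨i, rfl⟩ := hx; exact h1 i
    | zero => exact smul_zero _
    | add x y _ _ hx hy => rw [smul_add, hx, hy, add_zero]
    | smul a x _ hx => rw [smul_comm, hx, smul_zero]
  let B : Matrix ι ι (AddMonoidAlgebra ℝ G) := Matrix.of fun i j =>
    (Pi.single i 1 : ι → AddMonoidAlgebra ℝ G) j - (q i : ℝ)⁻¹ • halfToReal ht (r i j)
  have hB := hdet B hqr
  have hCB : (halfToReal ht).mapMatrix C =
      Matrix.diagonal (fun i => ((q i : ℕ) : AddMonoidAlgebra ℝ G)) * (1 - B) := by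
    refine Matrix.ext fun i j => ?_
    rw [Matrix.diagonal_mul, Matrix.sub_apply, Matrix.one_apply, RingHom.mapMatrix_apply,
      Matrix.map_apply]
    have h1 : (Pi.single i 1 : ι → AddMonoidAlgebra ℝ G) j = if i = j then 1 else 0 := by
      rw [Pi.single_apply]
      simp only [eq_comm]
    change halfToReal ht (r i j) = (q i : AddMonoidAlgebra ℝ G) *
      ((if i = j then 1 else 0) -
        ((Pi.single i 1 : ι → AddMonoidAlgebra ℝ G) j - (q i : ℝ)⁻¹ • halfToReal ht (r i j)))
    have h2 : (q i : ℝ) ≠ 0 := Nat.cast_ne_zero.2 (hq i).ne'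
    rw [h1, sub_sub_cancel, ← nsmul_eq_mul, ← Nat.cast_smul_eq_nsmul ℝ, smul_smul,
      mul_inv_cancel₀ h2, one_smul]
  have hdetC : halfToReal ht C.det = ((∏ i, q i : ℕ) : AddMonoidAlgebra ℝ G) * (1 - B).det := by
    rw [RingHom.map_det, hCB, Matrix.det_mul, Matrix.det_diagonal, Nat.cast_prod]
  have hQ : 0 < ∏ i, q i := Finset.prod_pos fun i _ => hq i
  -- With `Q = ∏ i, q i`, the element `p = Q - det C` acts as `Q`, and its norm is `Q * ‖1 - det (1
  -- - B)‖ < Q`.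
  let p : halfRing ℤ ht := ((∏ i, q i : ℕ) : halfRing ℤ ht) - C.det
  refine ⟨∏ i, q i, p, p.2, ?_, fun m => ?_⟩
  · rw [← halfToReal_apply, map_sub, map_natCast, hdetC, ← mul_one_sub, ← nsmul_eq_mul,
      ← Nat.cast_smul_eq_nsmul ℝ, norm_smul, Real.norm_natCast]
    have : (0 : ℝ) < (∏ i, q i : ℕ) := by exact_mod_cast hQ
    nlinarith
  · change p • m = _
    rw [sub_smul, hC, sub_zero, Nat.cast_smul_eq_nsmul]

end GroupRing

/-! ### Half-expansiveness makes the dual module contracted -/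

theorem UnitAddCircle.norm_coe_le_abs (x : ℝ) : ‖(x : UnitAddCircle)‖ ≤ |x| := by
  rw [UnitAddCircle.norm_eq]
  simpa using round_le x 0

/-- Every neighbourhood of zero contains one given by finitely many characters. -/
theorem exists_finset_characters_subset {X : Type*} [AddCommGroup X] [TopologicalSpace X]
    [IsTopologicalAddGroup X] [CompactSpace X] [T2Space X] {U : Set X} (hU : U ∈ nhds 0) :
    ∃ s : Finset (X →ₜ+ UnitAddCircle), ∃ δ : ℝ, 0 < δ ∧
      ∀ x, (∀ χ ∈ s, ‖χ x‖ < δ) → x ∈ U := by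
  classical
  have hne : ∀ y : X, y ∉ interior U → y ≠ 0 := fun y hy h =>
    hy (h ▸ mem_interior_iff_mem_nhds.2 hU)
  choose! χ hχ using fun (y : X) (hy : y ≠ 0) => exists_character_ne_zero hy
  -- Each point outside `interior U` has a neighbourhood on which one character stays away from 0;
  -- finitely many of these cover.
  have hcomp : IsCompact (interior U)ᶜ := isOpen_interior.isClosed_compl.isCompact
  obtain ⟨t, ht, hcover⟩ := hcomp.elim_nhds_subcover
    (fun y => {x | ‖χ y y‖ / 2 < ‖χ y x‖}) (fun y hy => by
      refine IsOpen.mem_nhds (isOpen_lt continuous_const (χ y).continuous_toFun.norm) ?_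
      exact half_lt_self (norm_pos_iff.2 (hχ y (hne y hy))))
  have hδ : ∀ᶠ δ in nhdsWithin (0 : ℝ) (Set.Ioi 0), ∀ y ∈ t, δ < ‖χ y y‖ / 2 := by
    refine (Filter.eventually_all_finset t).2 fun y hy => ?_
    exact nhdsWithin_le_nhds
      (Iio_mem_nhds (half_pos (norm_pos_iff.2 (hχ y (hne y (ht y hy))))))
  obtain ⟨δ, hδ, hδ0⟩ := (hδ.and self_mem_nhdsWithin).exists
  refine ⟨t.image χ, δ, hδ0, fun x hx => ?_⟩
  by_contra hxU
  obtain ⟨y, hy, hxy⟩ := Set.mem_iUnion₂.1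
    (hcover (show x ∈ (interior U)ᶜ from fun h => hxU (interior_subset h)))
  exact lt_asymm ((hx _ (Finset.mem_image_of_mem χ hy)).trans (hδ y hy)) hxy

namespace AlgebraicZdAction

variable {d : ℕ} {X : Type*} [AddCommGroup X] [TopologicalSpace X]

theorem HalfExpansive.exists_finset_characters [IsTopologicalAddGroup X] [CompactSpace X]
    [T2Space X] {α : AlgebraicZdAction d X} {ht : (Fin d → ℤ) →+ ℝ} (hα : α.HalfExpansive ht) :
    ∃ s : Finset α.DualModule, ∃ δ : ℝ, 0 < δ ∧ ∀ x, (∀ χ ∈ s, ∀ n, ht n ≤ 0 →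
      ‖χ (α.action (Multiplicative.ofAdd n) x)‖ < δ) → x = 0 := by
  obtain ⟨U, hU, h⟩ := hα
  obtain ⟨s, δ, hδ, hs⟩ := exists_finset_characters_subset hU
  exact ⟨s, δ, hδ, fun x hx => h x fun n hn => hs _ fun χ hχ => hx χ hχ n hn⟩

/-- A point killed by the span has a half-orbit killed by `s`, hence is 0. So the span separates
points, and a separating group of characters is everything. -/
theorem span_eq_top_of_small_orbits [IsTopologicalAddGroup X] [CompactSpace X]
    [T2Space X] {α : AlgebraicZdAction d X} {ht : (Fin d → ℤ) →+ ℝ} {s : Finset α.DualModule}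
    {δ : ℝ} (hδ : 0 < δ) (h : ∀ x, (∀ χ ∈ s, ∀ n, ht n ≤ 0 →
      ‖χ (α.action (Multiplicative.ofAdd n) x)‖ < δ) → x = 0) :
    Submodule.span (halfRing ℤ ht) (s : Set α.DualModule) = ⊤ := by
  let W : AddSubgroup α.DualModule :=
    (Submodule.span (halfRing ℤ ht) (s : Set α.DualModule)).toAddSubgroup
  have hW : W = ⊤ := by
    refine eq_top_of_separates (X := X) W fun x hx => ?_
    by_contra! hcon
    refine hx (h x fun χ hχ n hn => ?_)
    let u : halfRing ℤ ht := ⟨AddMonoidAlgebra.single n 1, single_mem_heightLE hn 1⟩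
    have hu : u • χ ∈ W := Submodule.smul_mem _ u (Submodule.subset_span hχ)
    have h1 : (AddMonoidAlgebra.single n (1 : ℤ) • χ) x = 0 := hcon (u • χ) hu
    rw [single_smul_apply, one_smul] at h1
    rwa [h1, norm_zero]
  exact Submodule.toAddSubgroup_injective hW

/-- Otherwise a bounded functional vanishes on all relations but not on the `i`-th basis vector. It
descends to the dual module, and a small multiple of it modulo 1 is evaluation at a point that
contradicts expansiveness. -/
theorem approx_relation_of_small_orbits [CompactSpace X] [T2Space X]
    {α : AlgebraicZdAction d X} {ht : (Fin d → ℤ) →+ ℝ} {s : Finset α.DualModule}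
    {δ : ℝ} (hδ : 0 < δ) (h : ∀ x, (∀ χ ∈ s, ∀ n, ht n ≤ 0 →
      ‖χ (α.action (Multiplicative.ofAdd n) x)‖ < δ) → x = 0)
    (hspan : Submodule.span (halfRing ℤ ht) (Set.range fun χ : s => (χ : α.DualModule)) = ⊤)
    [DecidableEq s] (i : s) {ε : ℝ} (hε : 0 < ε) :
    ∃ q : ℕ, 0 < q ∧ ∃ r : s → halfRing ℤ ht, ∑ j, r j • (j : α.DualModule) = 0 ∧
      ∀ j, ‖(Pi.single i 1 : s → AddMonoidAlgebra ℝ (Fin d → ℤ)) j -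
        (q : ℝ)⁻¹ • halfToReal ht (r j)‖ < ε := by
  let Φ : (s → halfRing ℤ ht) →+ α.DualModule :=
    (Fintype.linearCombination (halfRing ℤ ht) fun χ : s => (χ : α.DualModule)).toAddMonoidHom
  have hΦ : ∀ r, Φ r = ∑ j, r j • (j : α.DualModule) := fun r => rfl
  have hΦsurj : Function.Surjective Φ := by
    intro χ
    have : χ ∈ Submodule.span (halfRing ℤ ht) (Set.range fun χ : s => (χ : α.DualModule)) :=
      hspan ▸ Submodule.mem_top
    rw [← Fintype.range_linearCombination] at this
    exact this
  let Ψ : (s → halfRing ℤ ht) →+ (s → AddMonoidAlgebra ℝ (Fin d → ℤ)) :=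
    (halfToReal ht).toAddMonoidHom.compLeft s
  have hΨ : ∀ r j, Ψ r j = halfToReal ht (r j) := fun r j => rfl
  rcases exists_nat_smul_approx_or_exists_dual (Φ.ker.map Ψ)
    (Pi.single i 1 : s → AddMonoidAlgebra ℝ (Fin d → ℤ)) with happ | ⟨f, hf0, hfi⟩
  · obtain ⟨q, hq, _, ⟨r, hr, rfl⟩, hlt⟩ := happ ε hε
    exact ⟨q, hq, r, hr, fun j => (norm_le_pi_norm _ j).trans_lt hlt⟩
  exfalso
  let F : (s → halfRing ℤ ht) →+ ℝ := f.toLinearMap.toAddMonoidHom.comp Ψ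
  have hker : Φ.ker ≤ F.ker := fun r hr => hf0 _ ⟨r, hr, rfl⟩
  let φ : α.DualModule →+ ℝ := Φ.liftOfSurjective hΦsurj ⟨F, hker⟩
  have hφ : ∀ r, φ (Φ r) = f (Ψ r) := fun r =>
    AddMonoidHom.liftOfRightInverse_comp_apply _ _ _ ⟨F, hker⟩ r
  have hsingle : ∀ (j : s) (n : Fin d → ℤ), ht n ≤ 0 →
      φ (AddMonoidAlgebra.single n (1 : ℤ) • (j : α.DualModule)) =
        f (Pi.single j (AddMonoidAlgebra.single n 1)) := by
    intro j n hn
    let u : halfRing ℤ ht := ⟨AddMonoidAlgebra.single n 1, single_mem_heightLE hn 1⟩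
    have h1 : Φ (Pi.single j u) = AddMonoidAlgebra.single n (1 : ℤ) • (j : α.DualModule) := by
      rw [hΦ, Finset.sum_eq_single j]
      · rw [Pi.single_eq_same]
        rfl
      · intro k _ hk
        rw [Pi.single_eq_of_ne hk, zero_smul]
      · exact fun hj => absurd (Finset.mem_univ j) hj
    rw [← h1, hφ]
    congr 1
    ext1 k
    rw [hΨ]
    by_cases hk : k = j
    · subst hk
      rw [Pi.single_eq_same, Pi.single_eq_same, halfToReal_apply,
        AddMonoidAlgebra.mapRingHom_single, map_one]
    · rw [Pi.single_eq_of_ne hk, Pi.single_eq_of_ne hk, map_zero]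
  have hnorm : ∀ (j : s) (n : Fin d → ℤ),
      |f (Pi.single j (AddMonoidAlgebra.single n 1))| ≤ ‖f‖ := by
    intro j n
    refine (f.le_opNorm _).trans ?_
    rw [Pi.norm_single, l1_norm_single, abs_one, mul_one]
  -- The bound by `δ` makes the half-orbit of the point small; the bound by 1 lets a value that is 0
  -- modulo 1 be 0 in `ℝ`.
  let a : ℝ := min δ 1 / (‖f‖ + 1)
  have hmin : 0 < min δ 1 := lt_min hδ one_pos
  have ha : 0 < a := div_pos hmin (by positivity)
  have haf : a * ‖f‖ < min δ 1 := by
    rw [div_mul_eq_mul_div, div_lt_iff₀ (by positivity)]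
    nlinarith
  obtain ⟨x, hx⟩ := exists_forall_apply_eq (X := X)
    (((QuotientAddGroup.mk' _ : ℝ →+ UnitAddCircle).comp (AddMonoidHom.mulLeft a)).comp φ)
  have hx' : ∀ χ : α.DualModule, χ x = ((a * φ χ : ℝ) : UnitAddCircle) := hx
  have hx0 : x = 0 := by
    refine h x fun χ hχ n hn => ?_
    have h1 := hx' (AddMonoidAlgebra.single n (1 : ℤ) • χ)
    rw [single_smul_apply, one_smul, hsingle ⟨χ, hχ⟩ n hn] at h1
    rw [h1]
    refine (UnitAddCircle.norm_coe_le_abs _).trans_lt ?_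
    rw [abs_mul, abs_of_pos ha]
    calc a * _ ≤ a * ‖f‖ := mul_le_mul_of_nonneg_left (hnorm ⟨χ, hχ⟩ n) ha.le
      _ < δ := haf.trans_le (min_le_left _ _)
  have h1 := hx' (AddMonoidAlgebra.single (0 : Fin d → ℤ) (1 : ℤ) • (i : α.DualModule))
  rw [hsingle i 0 (by simp), hx0, map_zero] at h1
  have h2 := UnitAddCircle.eq_zero_of_abs_lt_one h1.symm (by
    rw [abs_mul, abs_of_pos ha]
    calc a * _ ≤ a * ‖f‖ := mul_le_mul_of_nonneg_left (hnorm i 0) ha.le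
      _ < 1 := haf.trans_le (min_le_right _ _))
  exact hfi ((mul_eq_zero.1 h2).resolve_left ha.ne')

theorem HalfExpansive.halfSpaceContracted [IsTopologicalAddGroup X] [CompactSpace X]
    [T2Space X] {α : AlgebraicZdAction d X} {ht : (Fin d → ℤ) →+ ℝ} (hα : α.HalfExpansive ht)
    {m₀ : Fin d → ℤ} (hm₀ : 0 < ht m₀) : HalfSpaceContracted ht α.DualModule := by
  classical
  obtain ⟨s, δ, hδ, h⟩ := hα.exists_finset_characters
  have hspan := span_eq_top_of_small_orbits hδ h
  have hspan' : Submodule.span (halfRing ℤ ht)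
      (Set.range fun χ : s => (χ : α.DualModule)) = ⊤ := by
    rw [← hspan]
    congr 1
    ext χ
    simp
  have hfin : Module.Finite (halfRing ℤ ht) α.DualModule := ⟨⟨s, hspan⟩⟩
  refine ⟨Module.Finite.of_restrictScalars_finite (halfRing ℤ ht) _ _,
    exists_neg_height_smul_eq_self hm₀, exists_smul_eq_nsmul_of_approx _ hspan' ?_⟩
  exact fun i ε hε => approx_relation_of_small_orbits hδ h hspan' i hε

/-! ### Quotients, subgroups and extensions -/

/-- Pulling characters back along the projection embeds the dual of `X ⧸ Y` in the dual of `X` as a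
submodule, and contraction passes to submodules. -/
theorem HalfExpansive.quotient [IsTopologicalAddGroup X] [CompactSpace X] [T2Space X]
    {α : AlgebraicZdAction d X} {ht : (Fin d → ℤ) →+ ℝ} (hα : α.HalfExpansive ht)
    {m₀ : Fin d → ℤ} (hm₀ : 0 < ht m₀) (Y : AddSubgroup X) (hY : α.Invariant Y)
    [T2Space (X ⧸ Y)] : (α.quotient Y hY).HalfExpansive ht := by
  refine halfExpansive_of_halfSpaceContracted _ ?_
  let π : X →ₜ+ X ⧸ Y := ⟨QuotientAddGroup.mk' Y, QuotientAddGroup.continuous_mk⟩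
  let f : (α.quotient Y hY).DualModule →+ α.DualModule :=
    AddMonoidHom.mk' (fun χ => ContinuousAddMonoidHom.comp (B := X ⧸ Y) χ π) fun _ _ => rfl
  have hf : ∀ χ x, f χ x = χ (x : X ⧸ Y) := fun _ _ => rfl
  refine (hα.halfSpaceContracted hm₀).of_injective
    { f with map_smul' := fun r χ => ?_ } fun χ ψ hχψ => ?_
  · change f (r • χ) = r • f χ
    induction r using AddMonoidAlgebra.induction_linear with
    | zero => rw [zero_smul, zero_smul, map_zero]
    | add r r' hr hr' => rw [add_smul, add_smul, map_add, hr, hr']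
    | single n a =>
      refine DualModule.ext fun x => ?_
      rw [hf, single_smul_apply, single_smul_apply, hf]
      rfl
  · refine DualModule.ext fun q => ?_
    obtain ⟨x, rfl⟩ := QuotientAddGroup.mk_surjective q
    exact congrArg (fun χ : α.DualModule => χ x) hχψ

theorem HalfExpansive.restrict {α : AlgebraicZdAction d X} {ht : (Fin d → ℤ) →+ ℝ}
    (hα : α.HalfExpansive ht) (Y : AddSubgroup X) (hY : α.Invariant Y) :
    (α.restrict Y hY).HalfExpansive ht := by
  obtain ⟨U, hU, h⟩ := hα
  refine ⟨(↑) ⁻¹' U, continuous_subtype_val.continuousAt.preimage_mem_nhds hU, fun y hy => ?_⟩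
  exact Subtype.ext (h y hy)

theorem HalfExpansive.of_restrict_of_quotient {α : AlgebraicZdAction d X}
    {ht : (Fin d → ℤ) →+ ℝ} {Y : AddSubgroup X} {hY : α.Invariant Y}
    (h₁ : (α.restrict Y hY).HalfExpansive ht) (h₂ : (α.quotient Y hY).HalfExpansive ht) :
    α.HalfExpansive ht := by
  obtain ⟨U, hU, h⟩ := h₁
  obtain ⟨V, hV, h'⟩ := h₂
  obtain ⟨W, hW, hWU⟩ := mem_nhds_subtype _ _ _ |>.1 hU
  refine ⟨W ∩ (QuotientAddGroup.mk : X → X ⧸ Y) ⁻¹' V, Filter.inter_mem hW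
    (QuotientAddGroup.continuous_mk.continuousAt.preimage_mem_nhds hV), fun x hx => ?_⟩
  have hxY : x ∈ Y := (QuotientAddGroup.eq_zero_iff x).1 (h' x fun n hn => (hx n hn).2)
  exact congrArg Subtype.val (h ⟨x, hxY⟩ fun n hn => hWU (hx n hn).1)

end AlgebraicZdAction

/-! ### Metrics and thickened half-spaces -/

namespace CompatibleMetric

variable {X : Type*} [AddCommGroup X] [t : TopologicalSpace X]

theorem t2Space {X : Type*} [t : TopologicalSpace X] (ρ : CompatibleMetric X) : T2Space X := by
  obtain ⟨m, rfl⟩ := ρ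
  infer_instance

/-- Subtraction is uniformly continuous on a compact group, so even a metric that is not
translation-invariant controls differences. -/
theorem exists_sub_mem [IsTopologicalAddGroup X] [CompactSpace X] (ρ : CompatibleMetric X)
    {U : Set X} (hU : U ∈ nhds 0) :
    ∃ ε : ℝ, 0 < ε ∧ ∀ x y, ρ.metric.edist x y ≤ ENNReal.ofReal ε → x - y ∈ U := by
  obtain ⟨m, rfl⟩ := ρ
  have huc : UniformContinuous fun p : X × X => p.1 - p.2 :=
    CompactSpace.uniformContinuous_of_continuous continuous_sub
  obtain ⟨r, hr, hrU⟩ := Metric.mem_nhds_iff.1 hU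
  obtain ⟨δ, hδ, h⟩ := Metric.uniformContinuous_iff.1 huc r hr
  refine ⟨δ / 2, half_pos hδ, fun x y hxy => hrU ?_⟩
  have h1 : dist x y ≤ δ / 2 := (edist_le_ofReal (half_pos hδ).le).1 hxy
  have h2 : dist (x, y) (y, y) < δ := by
    rw [Prod.dist_eq, dist_self, max_eq_left dist_nonneg]
    linarith
  simpa using h h2

theorem exists_edist_le [IsTopologicalAddGroup X] [CompactSpace X] (ρ : CompatibleMetric X)
    {ε : ℝ} (hε : 0 < ε) :
    ∃ U ∈ nhds (0 : X), ∀ x y, x - y ∈ U → ρ.metric.edist x y ≤ ENNReal.ofReal ε := by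
  obtain ⟨m, rfl⟩ := ρ
  have huc : UniformContinuous fun p : X × X => p.1 + p.2 :=
    CompactSpace.uniformContinuous_of_continuous continuous_add
  obtain ⟨δ, hδ, h⟩ := Metric.uniformContinuous_iff.1 huc ε hε
  refine ⟨Metric.ball 0 δ, Metric.ball_mem_nhds 0 hδ, fun x y hxy => ?_⟩
  refine (edist_le_ofReal hε.le).2 ?_
  have h2 : dist (x - y, y) (0, y) < δ := by
    rw [Prod.dist_eq, dist_self, max_eq_left dist_nonneg]
    exact hxy
  simpa using (h h2).le

end CompatibleMetric

/-- The height of an integer point in the direction `v`. -/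
noncomputable def heightAlong {d : ℕ} (v : EuclideanSpace ℝ (Fin d)) : (Fin d → ℤ) →+ ℝ :=
  AddMonoidHom.mk' (fun n => inner ℝ (intPoint n) v) fun m n => by
    rw [← inner_add_left]
    congr 1
    ext i
    simp [intPoint]

theorem heightAlong_apply {d : ℕ} (v : EuclideanSpace ℝ (Fin d)) (n : Fin d → ℤ) :
    heightAlong v n = inner ℝ (intPoint n) v := rfl

theorem exists_heightAlong_pos {d : ℕ} {v : EuclideanSpace ℝ (Fin d)} (hv : v ≠ 0) :
    ∃ m, 0 < heightAlong v m := by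
  obtain ⟨i, hi⟩ : ∃ i, v i ≠ 0 := by
    by_contra! h
    exact hv (PiLp.ext h)
  have h1 : heightAlong v (Pi.single i 1) = v i := by
    rw [heightAlong_apply, PiLp.inner_apply, Finset.sum_eq_single i]
    · simp [intPoint]
    · intro j _ hj
      simp [intPoint, Pi.single_eq_of_ne hj]
    · simp
  rcases lt_or_gt_of_ne hi with h | h
  · exact ⟨-Pi.single i 1, by rw [map_neg, h1]; linarith⟩
  · exact ⟨Pi.single i 1, by rwa [h1]⟩

theorem inner_le_of_mem_cthickening_halfSpace {d : ℕ} {v : EuclideanSpace ℝ (Fin d)}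
    (hv : ‖v‖ = 1) {t : ℝ} (ht : 0 ≤ t) {x : EuclideanSpace ℝ (Fin d)}
    (hx : x ∈ Metric.cthickening t (halfSpace v)) : inner ℝ x v ≤ t := by
  rw [Metric.mem_cthickening_iff] at hx
  have h1 : ENNReal.ofReal (inner ℝ x v) ≤ Metric.infEDist x (halfSpace v) := by
    refine Metric.le_infEDist.2 fun y hy => ?_
    rw [edist_dist]
    refine ENNReal.ofReal_le_ofReal ?_
    have hy' : inner ℝ y v ≤ 0 := hy
    calc inner ℝ x v ≤ inner ℝ (x - y) v := by rw [inner_sub_left]; linarith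
      _ ≤ ‖x - y‖ * ‖v‖ := real_inner_le_norm _ _
      _ = dist x y := by rw [hv, mul_one, dist_eq_norm]
  exact (ENNReal.ofReal_le_ofReal_iff ht).1 (h1.trans hx)

namespace AlgebraicZdAction

variable {d : ℕ} {X : Type*} [AddCommGroup X] [TopologicalSpace X]

/-- The thickness `t` is immaterial: a shift by a multiple of a vector of positive height moves the
thickened half-space into the original one. -/
theorem expansiveAlong_halfSpace_iff [IsTopologicalAddGroup X] [CompactSpace X]
    (α : AlgebraicZdAction d X) (ρ : CompatibleMetric X) {v : EuclideanSpace ℝ (Fin d)}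
    (hv : ‖v‖ = 1) :
    α.action.ExpansiveAlong ρ (halfSpace v) ↔ α.HalfExpansive (heightAlong v) := by
  have hv0 : v ≠ 0 := norm_ne_zero_iff.1 (by rw [hv]; exact one_ne_zero)
  have hzero : ∀ n, α.action n 0 = 0 := fun n => map_zero (α.endo n)
  constructor
  · rintro ⟨ε, hε, t, ht, h⟩
    obtain ⟨U, hU, hUε⟩ := ρ.exists_edist_le hε
    obtain ⟨m₀, hm₀⟩ := exists_heightAlong_pos hv0
    obtain ⟨N, hN⟩ := exists_nat_ge (t / heightAlong v m₀)
    rw [div_le_iff₀ hm₀] at hN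
    refine ⟨U, hU, fun x hx => ?_⟩
    -- Integer points of the thickening have height at most `t ≤ N * heightAlong v m₀`, so on them
    -- the shifted point only visits the half-orbit of `x`.
    have h1 : α.action (Multiplicative.ofAdd (-(N • m₀))) x = 0 := by
      refine h _ _ (iSup₂_le fun n hn => hUε _ _ ?_)
      rw [hzero, sub_zero, ← action_mul_apply, ← ofAdd_add]
      refine hx _ ?_
      have h2 := inner_le_of_mem_cthickening_halfSpace hv ht.le hn
      rw [← heightAlong_apply] at h2
      rw [map_add, map_neg, map_nsmul, nsmul_eq_mul]
      linarith
    have h3 := congrArg (α.action (Multiplicative.ofAdd (N • m₀))) h1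
    rwa [hzero, ← action_mul_apply, ← ofAdd_add, add_neg_cancel, ofAdd_zero,
      action_one_apply] at h3
  · rintro ⟨U, hU, h⟩
    obtain ⟨ε, hε, hεU⟩ := ρ.exists_sub_mem hU
    refine ⟨ε, hε, 1, one_pos, fun x y hxy => sub_eq_zero.1 (h _ fun n hn => ?_)⟩
    have h1 : α.action (Multiplicative.ofAdd n) (x - y) =
        α.action (Multiplicative.ofAdd n) x - α.action (Multiplicative.ofAdd n) y :=
      map_sub (α.endo (Multiplicative.ofAdd n)) x y
    rw [h1]
    exact hεU _ _ ((iSup₂_le_iff.1 hxy) n (Metric.self_subset_cthickening _ hn))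

end AlgebraicZdAction

theorem proposition4p9 {d : ℕ} {X : Type*} [AddCommGroup X] [TopologicalSpace X]
    [IsTopologicalAddGroup X] [CompactSpace X]
    (α : AlgebraicZdAction d X) (Y : AddSubgroup X) (hYc : IsCompact (Y : Set X))
    (hY : α.Invariant Y)
    (H : Set (EuclideanSpace ℝ (Fin d))) (hH : H ∈ halfSpaces d)
    (ρ : CompatibleMetric X) (ρY : CompatibleMetric Y) (ρQ : CompatibleMetric (X ⧸ Y)) :
    α.action.ExpansiveAlong ρ H ↔
      (α.restrict Y hY).action.ExpansiveAlong ρY H ∧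
        (α.quotient Y hY).action.ExpansiveAlong ρQ H := by
  obtain ⟨v, hv, rfl⟩ := hH
  have : CompactSpace Y := isCompact_iff_compactSpace.1 hYc
  have : T2Space X := ρ.t2Space
  have : T2Space (X ⧸ Y) := ρQ.t2Space
  obtain ⟨m₀, hm₀⟩ := exists_heightAlong_pos (norm_ne_zero_iff.1 (by rw [hv]; exact one_ne_zero))
  rw [α.expansiveAlong_halfSpace_iff ρ hv, (α.restrict Y hY).expansiveAlong_halfSpace_iff ρY hv,
    (α.quotient Y hY).expansiveAlong_halfSpace_iff ρQ hv]
  exact ⟨fun h => ⟨h.restrict Y hY, h.quotient hm₀ Y hY⟩,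
    fun h => .of_restrict_of_quotient h.1 h.2⟩
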